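/- Let $d\ge 0$ be an integer, let $X$ be a random vector in $\mathbb{R}^d$ with density $p$ with respect to Lebesgue measure, let $G$ be a $d$-dimensional standard Gaussian vector independent of $X$, let $\sigma>0$, and put $Z=X+\sigma G$. Definitions. A function $f:\mathbb{R}^d\to[0,\infty)$ is log-concave if $f=e^{-\varphi}$ for some convex $\varphi:\mathbb{R}^d\to(-\infty,\infty]$. For $v>0$ let $\phi_{vI}(x)=(2\pi v)^{-d/2}e^{-\|x\|^2/(2v)}$; $SLC_1(v,d)$ is the class of probability densities on $\mathbb{R}^d$ of the form $g\,\phi_{vI}$ with $g$ log-concave. A random vector is called log-concave (resp. is said to belong to $SLC_1(v,d)$) if it has a log-concave density (resp. a density in $SLC_1(v,d)$). The score of a density $r$ is $\rho_r=\nabla(-\log r)$, and the Fisher information matrix for location of a random vector $Y$ with density $r$ is $J(Y)=\mathbb{E}[\rho_r(Y)\rho_r(Y)^T]$; it is finite if all the entries of $\rho_r(Y)\rho_r(Y)^T$ are integrable. Write $q=\phi_{\sigma^2 I}$. For $z\in\mathbb{R}^d$ let $\kappa_z$ be the measure on $\mathbb{R}^d$ with density $u\mapsto p(z-u)q(u)/\int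 p(z-v)q(v)\,dv$. Then: (i) If $X$ is log-concave, then $Z$ is log-concave. (ii) If $X\in SLC_1(\tau^2,d)$ for some $\tau>0$, then $Z\in SLC_1(\tau^2+\sigma^2,d)$. (iii) $\sigma G$ has density $q$, with score $\rho_{\sigma G}(x)=\sigma^{-2}x$. For every $z$, $\kappa_z$ is a probability measure with finite first moment, and $(\kappa_z)_z$ is a version of the conditional law of $\sigma G$ given $Z=z$; write $\mathbb{E}[h(\sigma G)\mid Z=z]=\int h\,d\kappa_z$. The vector $Z$ has a density $p_Z$ with respect to Lebesgue measure that is positive everywhere on $\mathbb{R}^d$, $\varphi_Z=-\log p_Z$ is $C^\infty$ on $\mathbb{R}^d$, and for every $z\in\mathbb{R}^d$ $$\nabla\varphi_Z(z)=\sigma^{-2}\,\mathbb{E}[\sigma G\mid X+\sigma G=z]=\mathbb{E}[\rho_{\sigma G}(\sigma G)\mid X+\sigma G=z].$$ (iv) The Fisher information matrices $J(Z)=\mathbb{E}[\nabla\varphi_Z(Z)\,\nabla\varphi_Z(Z)^T]$ and $J(\sigma G)$ are finite, and $J(Z)\le J(\sigma G)=\sigma^{-2}I_d$ in the order of symmetric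 matrices (the difference $J(\sigma G)-J(Z)$ is positive semidefinite). -/

import Mathlib

open MeasureTheory ProbabilityTheory Set
open scoped ContDiff

noncomputable section

namespace GaussConv

/-- The space `ℝ^d` with its Euclidean norm. -/
abbrev E (d : ℕ) : Type := EuclideanSpace ℝ (Fin d)

/-- Convexity of a function with values in `(-∞, ∞]`. -/
structure IsExtConvex {d : ℕ} (φ : E d → EReal) : Prop where
  ne_bot : ∀ x, φ x ≠ ⊥
  convex : ∀ x y : E d, ∀ θ : ℝ, 0 < θ → θ < 1 →
    φ (θ • x + (1 - θ) • y) ≤ (θ : EReal) * φ x + ((1 - θ : ℝ) : EReal) * φ y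

/-- A log-concave function: `f = exp (-φ)` with `φ : ℝ^d → (-∞, ∞]` convex. -/
def IsLogConcaveFun {d : ℕ} (f : E d → ℝ) : Prop :=
  ∃ φ : E d → EReal, IsExtConvex φ ∧ ∀ x, f x = (EReal.exp (-φ x)).toReal

/-- A probability density function with respect to Lebesgue measure on `ℝ^d`. -/
structure IsDensity {d : ℕ} (p : E d → ℝ) : Prop where
  aemeasurable : AEMeasurable p volume
  nonneg : ∀ x, 0 ≤ p x
  lintegral_eq_one : ∫⁻ x, ENNReal.ofReal (p x) = 1

/-- The random vector `X` has density `p` with respect to Lebesgue measure. -/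
structure HasDensity {Ω : Type*} [MeasurableSpace Ω] {d : ℕ} (P : Measure Ω) (X : Ω → E d)
    (p : E d → ℝ) : Prop where
  isDensity : IsDensity p
  hasLaw : HasLaw X (volume.withDensity fun x => ENNReal.ofReal (p x)) P

/-- The density `φ_{v I}` of the centred Gaussian law on `ℝ^d` with covariance matrix `v I`. -/
def gaussDensity (d : ℕ) (v : ℝ) (x : E d) : ℝ :=
  (2 * Real.pi * v) ^ (-(d : ℝ) / 2) * Real.exp (-‖x‖ ^ 2 / (2 * v))

/-- The strongly log-concave densities on `ℝ^d` with variance parameter `v`: the density functions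
of the form `g · φ_{v I}` with `g` log-concave. -/
def SLC1 (v : ℝ) (d : ℕ) : Set (E d → ℝ) :=
  {p | IsDensity p ∧ ∃ g : E d → ℝ, IsLogConcaveFun g ∧ ∀ x, p x = g x * gaussDensity d v x}

/-- A log-concave random vector: it has a log-concave density. -/
def IsLogConcaveRV {Ω : Type*} [MeasurableSpace Ω] {d : ℕ} (P : Measure Ω) (X : Ω → E d) : Prop :=
  ∃ f : E d → ℝ, HasDensity P X f ∧ IsLogConcaveFun f

/-- `X ∈ SLC₁(v, d)` for a random vector `X`: it has a density in the class `SLC₁(v, d)`. -/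
def IsSLC1RV {Ω : Type*} [MeasurableSpace Ω] {d : ℕ} (P : Measure Ω) (X : Ω → E d) (v : ℝ) : Prop :=
  ∃ f : E d → ℝ, HasDensity P X f ∧ f ∈ SLC1 v d

/-- The score `ρ = ∇ (-log p)` of a density `p`. -/
def score {d : ℕ} (p : E d → ℝ) (x : E d) : E d :=
  gradient (fun y => -Real.log (p y)) x

/-- The conditional law of `W` given `X + W = z`, where `X` and `W` are independent with
densities `p` and `q`; it has density `u ↦ p (z - u) q u / ∫ v, p (z - v) q v`. -/
def condLawSummand {d : ℕ} (p q : E d → ℝ) (z : E d) : Measure (E d) :=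
  volume.withDensity fun u =>
    ENNReal.ofReal (p (z - u) * q u / ∫ v, p (z - v) * q v)

/-- The Fisher information for location of `Y`, whose density is `p`, is finite: all entries of
the matrix `ρ(Y) ρ(Y)ᵀ` are integrable. -/
def HasFiniteFisherInfo {Ω : Type*} [MeasurableSpace Ω] {d : ℕ} (P : Measure Ω) (Y : Ω → E d)
    (p : E d → ℝ) : Prop :=
  ∀ i j : Fin d, Integrable (fun a => score p (Y a) i * score p (Y a) j) P

/-- The Fisher information matrix for location `J(Y) = E[ρ(Y) ⊗ ρ(Y)]`, where `ρ` is the score of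
the density `p` of `Y`. -/
def fisherInfo {Ω : Type*} [MeasurableSpace Ω] {d : ℕ} (P : Measure Ω) (Y : Ω → E d)
    (p : E d → ℝ) : Matrix (Fin d) (Fin d) ℝ :=
  Matrix.of fun i j => ∫ a, score p (Y a) i * score p (Y a) j ∂P

end GaussConv

end

namespace GaussConv

open scoped ENNReal Pointwise

/-! ### The Prékopa–Leindler inequality -/

/-! The joint law of `(Z, σG)` has density `p (z - u) * q u`. Integrating out `u` gives the density
of `Z`, the convolution `gaussConv p (σ ^ 2)`; dividing by it gives the conditional law `κ_z`. The
remaining claims are facts about this convolution.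

Log-concavity rests on the Prékopa–Leindler inequality, which passes from the line to `ℝ^d` by
Tonelli and makes the integral in `x` of a log-concave function of `(x, z)` log-concave in `z`. For
(i) this function is `f x * q (z - x)`. For (ii), completing the square in `φ_t(x) φ_v(z - x)`
extracts the factor `φ_{t+v}(z)` and leaves a Gaussian in `x - (t/(t+v)) z`, so the cofactor is
log-concave by the same theorem.

Smoothness comes from writing the convolution as a Gaussian times the Laplace transform of a finite
measure with all exponential moments. Differentiating the Gaussian factor gives Tweedie's formula:
the score of `Z` at `z` is `σ⁻²` times the mean of `κ_z`. The score of `Z` is therefore the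
conditional expectation of the score of `σG` given `Z`, and (iv) is the contraction property of
conditional expectation in `L²`, tested on each direction. -/

theorem volume_add_volume_le_of_isCompact {A B C : Set ℝ} (hA : IsCompact A) (hB : IsCompact B)
    (hA0 : A.Nonempty) (hB0 : B.Nonempty) (h : ∀ a ∈ A, ∀ b ∈ B, a + b ∈ C) :
    volume A + volume B ≤ volume C := by
  obtain ⟨a, haA, ha⟩ := hA.exists_isGreatest hA0
  obtain ⟨b, hbB, hb⟩ := hB.exists_isLeast hB0
  have h1 : volume ((fun x => x + b) '' A) = volume A := by simp
  have h2 : volume ((fun x => a + x) '' B) = volume B := by simp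
  have hmA : MeasurableSet ((fun x => x + b) '' A) :=
    (hA.image (by fun_prop)).measurableSet
  have hsub : (fun x => x + b) '' A ∪ (fun x => a + x) '' B ⊆ C := by
    rintro _ (⟨x, hx, rfl⟩ | ⟨x, hx, rfl⟩)
    · exact h x hx b hbB
    · exact h a haA x hx
  -- With `a = max A` and `b = min B`, the first translate lies to the left of `a + b` and the
  -- second to the right, so they share at most that point.
  have hdisj : AEDisjoint volume ((fun x => x + b) '' A) ((fun x => a + x) '' B) := by
    refine measure_mono_null (t := {a + b}) ?_ (by simp)
    rintro _ ⟨⟨x, hx, rfl⟩, ⟨y, hy, hxy⟩⟩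
    have hx' := ha hx
    have hy' := hb hy
    simp only [mem_singleton_iff] at hxy ⊢
    linarith
  rw [← h1, ← h2, ← measure_union₀' hmA.nullMeasurableSet hdisj]
  exact measure_mono hsub

/-- The one-dimensional Brunn–Minkowski inequality. -/
theorem volume_add_volume_le {A B C : Set ℝ} (hA : MeasurableSet A) (hB : MeasurableSet B)
    (hA0 : A.Nonempty) (hB0 : B.Nonempty) (h : ∀ a ∈ A, ∀ b ∈ B, a + b ∈ C) :
    volume A + volume B ≤ volume C := by
  obtain ⟨a, ha⟩ := hA0
  obtain ⟨b, hb⟩ := hB0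
  rw [hA.measure_eq_iSup_isCompact, hB.measure_eq_iSup_isCompact]
  simp_rw [iSup_and']
  refine ENNReal.biSup_add_biSup_le' ⟨∅, by simp⟩ ⟨∅, by simp⟩ ?_
  rintro K ⟨hKA, hK⟩ L ⟨hLB, hL⟩
  -- The approximating compact sets may be empty; adjoining a point of `A` and one of `B` keeps them
  -- compact and makes them nonempty.
  refine (add_le_add (measure_mono (subset_insert a K)) (measure_mono (subset_insert b L))).trans ?_
  refine volume_add_volume_le_of_isCompact (hK.insert a) (hL.insert b) (insert_nonempty _ _)
    (insert_nonempty _ _) fun x hx y hy => h x ?_ y ?_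
  · exact insert_subset ha hKA hx
  · exact insert_subset hb hLB hy

theorem ofReal_mul_volume_add_le {A B C : Set ℝ} {s t : ℝ} (hs : 0 < s) (ht : 0 < t)
    (hA : MeasurableSet A) (hB : MeasurableSet B) (hA0 : A.Nonempty) (hB0 : B.Nonempty)
    (h : ∀ a ∈ A, ∀ b ∈ B, s * a + t * b ∈ C) :
    ENNReal.ofReal s * volume A + ENNReal.ofReal t * volume B ≤ volume C := by
  have h1 : ENNReal.ofReal s * volume A = volume (s • A) := by
    simp [Measure.addHaar_smul, abs_of_pos hs]
  have h2 : ENNReal.ofReal t * volume B = volume (t • B) := by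
    simp [Measure.addHaar_smul, abs_of_pos ht]
  rw [h1, h2]
  refine volume_add_volume_le (hA.const_smul₀ s) (hB.const_smul₀ t) hA0.smul_set hB0.smul_set ?_
  rintro _ ⟨a, ha, rfl⟩ _ ⟨b, hb, rfl⟩
  exact h a ha b hb

theorem rpow_mul_rpow_le_add {θ : ℝ} (h0 : 0 < θ) (h1 : θ < 1) (a b : ℝ≥0∞) :
    a ^ θ * b ^ (1 - θ) ≤ ENNReal.ofReal θ * a + ENNReal.ofReal (1 - θ) * b := by
  have h1' : 0 < 1 - θ := by linarith
  by_cases ha : a = ⊤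
  · simp [ha, ENNReal.mul_top, h0]
  by_cases hb : b = ⊤
  · simp [hb, ENNReal.mul_top, h1]
  lift a to NNReal using ha
  lift b to NNReal using hb
  have := NNReal.geom_mean_le_arith_mean2_weighted ⟨θ, h0.le⟩ ⟨1 - θ, h1'.le⟩ a b
    (NNReal.eq (add_sub_cancel θ 1))
  rw [← ENNReal.coe_rpow_of_nonneg _ h0.le, ← ENNReal.coe_rpow_of_nonneg _ h1'.le,
    ENNReal.ofReal_eq_coe_nnreal h0.le, ENNReal.ofReal_eq_coe_nnreal h1'.le]
  exact_mod_cast this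

/-- The Prékopa–Leindler inequality holds for the measure `μ`. -/
def PrekopaLeindler {V : Type*} [AddCommGroup V] [Module ℝ V] [MeasurableSpace V]
    (μ : Measure V) : Prop :=
  ∀ θ : ℝ, 0 < θ → θ < 1 → ∀ f g h : V → ℝ≥0∞, Measurable f → Measurable g → Measurable h →
    (∀ x y, f x ^ θ * g y ^ (1 - θ) ≤ h (θ • x + (1 - θ) • y)) →
    (∫⁻ x, f x ∂μ) ^ θ * (∫⁻ x, g x ∂μ) ^ (1 - θ) ≤ ∫⁻ x, h x ∂μ

/-- Layer-cake formula; levels `t ≥ 1` contribute nothing. Staying below level 1 keeps the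
superlevel sets nonempty when the supremum is 1, as Brunn–Minkowski requires. -/
theorem lintegral_eq_lintegral_Ioo_meas_lt {f : ℝ → ℝ≥0∞} (hf : Measurable f)
    (hf1 : ∀ x, f x ≤ 1) :
    ∫⁻ x, f x = ∫⁻ t in Ioo (0 : ℝ) 1, volume {x | ENNReal.ofReal t < f x} := by
  have hfin : ∀ x, f x ≠ ⊤ := fun x => ((hf1 x).trans_lt ENNReal.one_lt_top).ne
  have key := lintegral_eq_lintegral_meas_lt (f := fun x => (f x).toReal) volume
    (Filter.Eventually.of_forall fun x => ENNReal.toReal_nonneg) hf.ennreal_toReal.aemeasurable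
  simp only [ENNReal.ofReal_toReal (hfin _)] at key
  rw [key, ← Ioo_union_Ici_eq_Ioi zero_lt_one, lintegral_union measurableSet_Ici]
  · have h0 : ∫⁻ t in Ici (1 : ℝ), volume {x | t < (f x).toReal} = 0 := by
      rw [setLIntegral_congr_fun (g := fun _ => 0) measurableSet_Ici, lintegral_zero]
      intro t ht
      have : {x | t < (f x).toReal} = ∅ := by
        ext x
        simp only [mem_ofPred_eq, mem_empty_iff_false, iff_false, not_lt]
        exact (ENNReal.toReal_mono ENNReal.one_ne_top (hf1 x)).trans (by simpa using ht)
      simp [this]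
    rw [h0, add_zero]
    refine setLIntegral_congr_fun measurableSet_Ioo fun t ht => ?_
    simp only [ENNReal.ofReal_lt_iff_lt_toReal ht.1.le (hfin _)]
  · exact disjoint_left.2 fun x hx hx' => (not_le.2 hx.2) hx'

/-- At each level `t < 1` the superlevel sets of `f` and `g` are nonempty and their weighted
Minkowski sum lies in that of `h`. One-dimensional Brunn–Minkowski, integrated over `t`, gives this
additive form, which is stronger than the geometric one. -/
theorem lintegral_add_le_of_iSup_eq_one {θ : ℝ} (h0 : 0 < θ) (h1 : θ < 1) {f g h : ℝ → ℝ≥0∞}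
    (hf : Measurable f) (hg : Measurable g) (hh : Measurable h) (hf1 : ⨆ x, f x = 1)
    (hg1 : ⨆ x, g x = 1) (H : ∀ x y, f x ^ θ * g y ^ (1 - θ) ≤ h (θ * x + (1 - θ) * y)) :
    ENNReal.ofReal θ * (∫⁻ x, f x) + ENNReal.ofReal (1 - θ) * (∫⁻ x, g x) ≤ ∫⁻ x, h x := by
  have h1' : 0 < 1 - θ := by linarith
  -- `h` may exceed 1, so it is truncated before the layer-cake formula is applied.
  refine le_trans ?_ (lintegral_mono fun x => min_le_left (h x) 1)
  have hmeas : ∀ {f : ℝ → ℝ≥0∞}, Measurable f →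
      Measurable fun t : ℝ => volume {x | ENNReal.ofReal t < f x} := by
    intro f hf
    refine Antitone.measurable fun s t hst => measure_mono fun x hx => ?_
    exact (ENNReal.ofReal_le_ofReal hst).trans_lt hx
  rw [lintegral_eq_lintegral_Ioo_meas_lt hf fun x => (le_iSup f x).trans hf1.le,
    lintegral_eq_lintegral_Ioo_meas_lt hg fun x => (le_iSup g x).trans hg1.le,
    lintegral_eq_lintegral_Ioo_meas_lt (hh.min measurable_const) fun x => min_le_right _ _,
    ← lintegral_const_mul _ (hmeas hf), ← lintegral_const_mul _ (hmeas hg),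
    ← lintegral_add_left ((hmeas hf).const_mul _)]
  refine setLIntegral_mono_ae' measurableSet_Ioo (Filter.Eventually.of_forall fun t ht => ?_)
  have ht1 : ENNReal.ofReal t < 1 := by simpa using ht.2
  have ht0 : ENNReal.ofReal t ≠ 0 := by simpa using ht.1
  refine ofReal_mul_volume_add_le h0 h1' (measurableSet_lt measurable_const hf)
    (measurableSet_lt measurable_const hg) ?_ ?_ ?_
  · exact lt_iSup_iff.1 (ht1.trans_eq hf1.symm)
  · exact lt_iSup_iff.1 (ht1.trans_eq hg1.symm)
  · intro a ha b hb
    refine lt_min ?_ ht1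
    refine lt_of_lt_of_le ?_ (H a b)
    calc ENNReal.ofReal t = ENNReal.ofReal t ^ θ * ENNReal.ofReal t ^ (1 - θ) := by
          rw [← ENNReal.rpow_add _ _ ht0 ENNReal.ofReal_ne_top]; simp
      _ < f a ^ θ * g b ^ (1 - θ) :=
          ENNReal.mul_lt_mul (ENNReal.rpow_lt_rpow ha h0) (ENNReal.rpow_lt_rpow hb h1')

/-- Dividing `f` and `g` by their suprema reduces to the normalised case; weighted AM–GM turns its
sum into a product, and the normalising constants cancel. -/
theorem prekopaLeindler_real_of_iSup_ne_top {θ : ℝ} (h0 : 0 < θ) (h1 : θ < 1) {f g h : ℝ → ℝ≥0∞}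
    (hf : Measurable f) (hg : Measurable g) (hh : Measurable h) (hf1 : ⨆ x, f x ≠ ⊤)
    (hg1 : ⨆ x, g x ≠ ⊤) (H : ∀ x y, f x ^ θ * g y ^ (1 - θ) ≤ h (θ * x + (1 - θ) * y)) :
    (∫⁻ x, f x) ^ θ * (∫⁻ x, g x) ^ (1 - θ) ≤ ∫⁻ x, h x := by
  have h1' : 0 < 1 - θ := by linarith
  by_cases ha0 : ⨆ x, f x = 0
  · have : f = fun _ => 0 := funext fun x => le_antisymm ((le_iSup f x).trans ha0.le) zero_le
    simp [this, h0]
  by_cases hb0 : ⨆ x, g x = 0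
  · have : g = fun _ => 0 := funext fun x => le_antisymm ((le_iSup g x).trans hb0.le) zero_le
    simp [this, h1]
  set a := ⨆ x, f x with ha
  set b := ⨆ x, g x with hb
  have key := lintegral_add_le_of_iSup_eq_one h0 h1 (f := fun x => a⁻¹ * f x)
    (g := fun x => b⁻¹ * g x) (h := fun x => (a⁻¹ ^ θ * b⁻¹ ^ (1 - θ)) * h x)
    (hf.const_mul _) (hg.const_mul _) (hh.const_mul _)
    (by rw [← ENNReal.mul_iSup, ← ha, ENNReal.inv_mul_cancel ha0 hf1])
    (by rw [← ENNReal.mul_iSup, ← hb, ENNReal.inv_mul_cancel hb0 hg1]) ?_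
  · have key2 := (rpow_mul_rpow_le_add h0 h1 _ _).trans key
    rw [lintegral_const_mul _ hf, lintegral_const_mul _ hg, lintegral_const_mul _ hh,
      ENNReal.mul_rpow_of_nonneg _ _ h0.le, ENNReal.mul_rpow_of_nonneg _ _ h1'.le,
      mul_mul_mul_comm] at key2
    have hc0 : a⁻¹ ^ θ * b⁻¹ ^ (1 - θ) ≠ 0 :=
      mul_ne_zero (by simp [h0.not_gt, hf1]) (by simp [h1.le, hg1])
    have hct : a⁻¹ ^ θ * b⁻¹ ^ (1 - θ) ≠ ⊤ :=
      ENNReal.mul_ne_top (ENNReal.rpow_ne_top_of_nonneg h0.le (by simpa using ha0))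
        (ENNReal.rpow_ne_top_of_nonneg h1'.le (by simpa using hb0))
    exact (ENNReal.mul_le_mul_iff_right hc0 hct).1 key2
  · intro x y
    rw [ENNReal.mul_rpow_of_nonneg _ _ h0.le, ENNReal.mul_rpow_of_nonneg _ _ h1'.le,
      mul_mul_mul_comm]
    gcongr
    exact H x y

theorem prekopaLeindler_real : PrekopaLeindler (volume : Measure ℝ) := by
  intro θ h0 h1 f g h hf hg hh H
  have h1' : 0 < 1 - θ := by linarith
  have htrunc : ∀ {f : ℝ → ℝ≥0∞}, Measurable f →
      Filter.Tendsto (fun n : ℕ => ∫⁻ x, min (f x) n) Filter.atTop (nhds (∫⁻ x, f x)) := by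
    intro f hf
    refine lintegral_tendsto_of_tendsto_of_monotone
      (fun n => (hf.min measurable_const).aemeasurable) ?_ ?_
    · exact Filter.Eventually.of_forall fun x m n hmn =>
        min_le_min le_rfl (by exact_mod_cast hmn)
    · refine Filter.Eventually.of_forall fun x => ?_
      have := (tendsto_const_nhds (x := f x)).min ENNReal.tendsto_nat_nhds_top
      simpa using this
  by_cases hf0 : ∫⁻ x, f x = 0
  · simp [hf0, h0]
  by_cases hg0 : ∫⁻ x, g x = 0
  · simp [hg0, h1]
  -- Neither integral vanishes here, which rules out `0 * ∞` and makes the product continuous at the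
  -- limit of the truncations `min f n`, `min g n`.
  refine le_of_tendsto (ENNReal.Tendsto.mul ((htrunc hf).ennrpow_const θ)
    (Or.inl ?_) ((htrunc hg).ennrpow_const (1 - θ)) (Or.inl ?_))
    (Filter.Eventually.of_forall fun n => ?_)
  · simp [hf0, h0.not_gt]
  · simp [hg0, h1.le]
  · refine prekopaLeindler_real_of_iSup_ne_top h0 h1 (hf.min measurable_const)
      (hg.min measurable_const) hh ?_ ?_ fun x y => le_trans ?_ (H x y)
    · exact ((iSup_le fun x => min_le_right _ _).trans_lt (ENNReal.natCast_lt_top n)).ne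
    · exact ((iSup_le fun x => min_le_right _ _).trans_lt (ENNReal.natCast_lt_top n)).ne
    · gcongr <;> exact min_le_left _ _

/-- The inequality for `ν` on the sections is exactly the hypothesis needed to apply the inequality
for `μ` to the partial integrals. -/
theorem PrekopaLeindler.prod {V W : Type*} [AddCommGroup V] [Module ℝ V] [MeasurableSpace V]
    [AddCommGroup W] [Module ℝ W] [MeasurableSpace W] {μ : Measure V} {ν : Measure W}
    [SFinite μ] [SFinite ν] (hμ : PrekopaLeindler μ) (hν : PrekopaLeindler ν) :
    PrekopaLeindler (μ.prod ν) := by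
  intro θ h0 h1 f g h hf hg hh H
  rw [lintegral_prod _ hf.aemeasurable, lintegral_prod _ hg.aemeasurable,
    lintegral_prod _ hh.aemeasurable]
  refine hμ θ h0 h1 _ _ _ hf.lintegral_prod_right' hg.lintegral_prod_right'
    hh.lintegral_prod_right' fun x x' => ?_
  refine hν θ h0 h1 _ _ _ (hf.comp measurable_prodMk_left) (hg.comp measurable_prodMk_left)
    (hh.comp measurable_prodMk_left) fun y y' => ?_
  exact H (x, y) (x', y')

theorem PrekopaLeindler.of_measurePreserving {V W : Type*} [AddCommGroup V] [Module ℝ V]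
    [MeasurableSpace V] [AddCommGroup W] [Module ℝ W] [MeasurableSpace W] {μ : Measure V}
    {ν : Measure W} (hμ : PrekopaLeindler μ) (e : V →ₗ[ℝ] W) (he : MeasurePreserving e μ ν) :
    PrekopaLeindler ν := by
  intro θ h0 h1 f g h hf hg hh H
  rw [← he.lintegral_comp hf, ← he.lintegral_comp hg, ← he.lintegral_comp hh]
  refine hμ θ h0 h1 _ _ _ (hf.comp he.measurable) (hg.comp he.measurable)
    (hh.comp he.measurable) fun x y => ?_
  simpa using H (e x) (e y)

theorem prekopaLeindler_pi (n : ℕ) : PrekopaLeindler (volume : Measure (Fin n → ℝ)) := by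
  induction n with
  | zero =>
    intro θ h0 h1 f g h hf hg hh H
    have hvol : (volume : Measure (Fin 0 → ℝ)) = Measure.dirac 0 := by
      rw [volume_pi, Measure.pi_of_empty _ 0]
    simp only [hvol, lintegral_dirac]
    simpa using H 0 0
  | succ n ih =>
    let e : (ℝ × (Fin n → ℝ)) →ₗ[ℝ] (Fin (n + 1) → ℝ) :=
      { toFun := fun x => Fin.cons x.1 x.2
        map_add' := by
          intro x y; ext i; refine Fin.cases ?_ (fun j => ?_) i <;> simp
        map_smul' := by
          intro c x; ext i; refine Fin.cases ?_ (fun j => ?_) i <;> simp }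
    refine (prekopaLeindler_real.prod ih).of_measurePreserving e ?_
    have he : ⇑e = (MeasurableEquiv.piFinSuccAbove (fun _ : Fin (n + 1) => ℝ) 0).symm := by
      ext x i
      refine Fin.cases ?_ (fun j => ?_) i <;> simp [e, MeasurableEquiv.piFinSuccAbove]
    rw [he]
    exact (volume_preserving_piFinSuccAbove (fun _ : Fin (n + 1) => ℝ) 0).symm

theorem prekopaLeindler_euclideanSpace (d : ℕ) : PrekopaLeindler (volume : Measure (E d)) :=
  (prekopaLeindler_pi d).of_measurePreserving
    (WithLp.linearEquiv 2 ℝ (Fin d → ℝ)).symm.toLinearMap (PiLp.volume_preserving_toLp (Fin d))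

/-! ### Log-concave functions -/

/-- This multiplicative form is what Prékopa–Leindler consumes. Points with `φ = ∞` correspond to
zeros of `f`, where `0 ^ θ = 0` makes the inequality trivial. -/
theorem isLogConcaveFun_iff {d : ℕ} {f : E d → ℝ} :
    IsLogConcaveFun f ↔ (∀ x, 0 ≤ f x) ∧ ∀ x y : E d, ∀ θ : ℝ, 0 < θ → θ < 1 →
      f x ^ θ * f y ^ (1 - θ) ≤ f (θ • x + (1 - θ) • y) := by
  constructor
  · rintro ⟨φ, hφ, hf⟩
    have h0 : ∀ x, 0 ≤ f x := fun x => by rw [hf]; exact ENNReal.toReal_nonneg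
    refine ⟨h0, fun x y θ hθ hθ1 => ?_⟩
    have htop : ∀ x, φ x = ⊤ → f x = 0 := fun x hx => by simp [hf, hx]
    have hcoe : ∀ x, φ x ≠ ⊤ → ∃ r : ℝ, φ x = r ∧ f x = Real.exp (-r) := by
      intro x hx
      refine ⟨(φ x).toReal, (EReal.coe_toReal hx (hφ.ne_bot x)).symm, ?_⟩
      rw [hf, ← EReal.coe_toReal hx (hφ.ne_bot x), ← EReal.coe_neg, EReal.exp_coe,
        ENNReal.toReal_ofReal (Real.exp_pos _).le, EReal.toReal_coe]
    have hθ1' : 0 < 1 - θ := by linarith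
    by_cases hx : φ x = ⊤
    · rw [htop x hx, Real.zero_rpow hθ.ne', zero_mul]; exact h0 _
    by_cases hy : φ y = ⊤
    · rw [htop y hy, Real.zero_rpow hθ1'.ne', mul_zero]; exact h0 _
    obtain ⟨r, hr, hfr⟩ := hcoe x hx
    obtain ⟨s, hs, hfs⟩ := hcoe y hy
    have hc := hφ.convex x y θ hθ hθ1
    rw [hr, hs, ← EReal.coe_mul, ← EReal.coe_mul, ← EReal.coe_add] at hc
    obtain ⟨t, ht, hft⟩ := hcoe (θ • x + (1 - θ) • y) (hc.trans_lt (EReal.coe_lt_top _)).ne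
    rw [ht, EReal.coe_le_coe_iff] at hc
    rw [hfr, hfs, hft, ← Real.exp_mul, ← Real.exp_mul, ← Real.exp_add, Real.exp_le_exp]
    linarith
  · rintro ⟨h0, hc⟩
    have hexp : ∀ x, EReal.exp (- -ENNReal.log (ENNReal.ofReal (f x))) = ENNReal.ofReal (f x) := by
      intro x; rw [neg_neg, ENNReal.exp_log]
    refine ⟨fun x => -ENNReal.log (ENNReal.ofReal (f x)), ⟨fun x => ?_, fun x y θ hθ hθ1 => ?_⟩,
      fun x => ?_⟩
    · rw [Ne, EReal.neg_eq_bot_iff, ENNReal.log_eq_top_iff]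
      exact ENNReal.ofReal_ne_top
    · have hθ1' : 0 < 1 - θ := by linarith
      have htop : ∀ x, ∀ t : ℝ, 0 < t → f x = 0 →
          (t : EReal) * -ENNReal.log (ENNReal.ofReal (f x)) = ⊤ := by
        intro x t ht hx
        simp [hx, EReal.coe_mul_top_of_pos ht]
      have hlog : ∀ x, 0 < f x →
          ENNReal.log (ENNReal.ofReal (f x)) = (Real.log (f x) : EReal) := by
        intro x hx
        rw [ENNReal.log_ofReal_of_pos hx]
      have hnb : ∀ x, ∀ t : ℝ, 0 < t →
          (t : EReal) * -ENNReal.log (ENNReal.ofReal (f x)) ≠ ⊥ := by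
        intro x t ht
        rcases (h0 x).eq_or_lt' with hx | hx
        · rw [htop x t ht hx]; exact top_ne_bot
        · rw [hlog x hx, ← EReal.coe_neg, ← EReal.coe_mul]; exact EReal.coe_ne_bot _
      rcases (h0 x).eq_or_lt' with hx | hx
      · rw [htop x θ hθ hx, EReal.top_add_of_ne_bot (hnb y _ hθ1')]; exact le_top
      rcases (h0 y).eq_or_lt' with hy | hy
      · rw [htop y _ hθ1' hy, EReal.add_top_of_ne_bot (hnb x _ hθ)]; exact le_top
      have hxy := hc x y θ hθ hθ1
      have hpos : 0 < f x ^ θ * f y ^ (1 - θ) := by positivity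
      rw [hlog x hx, hlog y hy, hlog _ (hpos.trans_le hxy), ← EReal.coe_neg, ← EReal.coe_neg,
        ← EReal.coe_neg, ← EReal.coe_mul, ← EReal.coe_mul, ← EReal.coe_add, EReal.coe_le_coe_iff]
      have := Real.log_le_log hpos hxy
      rw [Real.log_mul (by positivity) (by positivity), Real.log_rpow hx, Real.log_rpow hy] at this
      linarith
    · rw [hexp, ENNReal.toReal_ofReal (h0 x)]

theorem IsLogConcaveFun.nonneg {d : ℕ} {f : E d → ℝ} (hf : IsLogConcaveFun f) (x : E d) :
    0 ≤ f x :=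
  (isLogConcaveFun_iff.1 hf).1 x

theorem IsLogConcaveFun.rpow_mul_rpow_le {d : ℕ} {f : E d → ℝ} (hf : IsLogConcaveFun f)
    (x y : E d) {θ : ℝ} (h0 : 0 < θ) (h1 : θ < 1) :
    f x ^ θ * f y ^ (1 - θ) ≤ f (θ • x + (1 - θ) • y) :=
  (isLogConcaveFun_iff.1 hf).2 x y θ h0 h1

/-- A log-concave function agrees almost everywhere with a Borel measurable one. -/
theorem IsLogConcaveFun.exists_measurable {d : ℕ} {f : E d → ℝ} (hf : IsLogConcaveFun f) :
    ∃ g : E d → ℝ, IsLogConcaveFun g ∧ Measurable g ∧ g =ᵐ[volume] f := by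
  have hconv : Convex ℝ {x | 0 < f x} := by
    refine convex_iff_forall_pos.2 fun x hx y hy a b ha hb hab => ?_
    have hx : 0 < f x := hx
    have hy : 0 < f y := hy
    obtain rfl : b = 1 - a := by linarith
    exact lt_of_lt_of_le (by positivity) (hf.rpow_mul_rpow_le x y ha (by linarith))
  have hconc : ConcaveOn ℝ {x | 0 < f x} fun x => Real.log (f x) := by
    refine concaveOn_iff_forall_pos.2 ⟨hconv, fun x hx y hy a b ha hb hab => ?_⟩
    have hx : 0 < f x := hx
    have hy : 0 < f y := hy
    obtain rfl : b = 1 - a := by linarith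
    have h := Real.log_le_log (by positivity) (hf.rpow_mul_rpow_le x y ha (by linarith))
    rwa [Real.log_mul (by positivity) (by positivity), Real.log_rpow hx, Real.log_rpow hy] at h
  have hint : Convex ℝ (interior {x | 0 < f x}) := hconv.interior
  have hfint : ∀ x ∈ interior {x | 0 < f x}, 0 < f x := fun x hx => by
    have h : x ∈ {x | 0 < f x} := interior_subset hx
    exact h
  -- On the frontier of its support `f` may fail to be measurable, so it is set to zero there. The
  -- interior of a convex set is convex, which preserves log-concavity, and the frontier is Lebesgue
  -- null. On the interior `log f` is concave and finite, hence continuous.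
  refine ⟨(interior {x | 0 < f x}).indicator f, isLogConcaveFun_iff.2 ⟨?_, ?_⟩, ?_, ?_⟩
  · exact fun x => indicator_nonneg (fun x _ => hf.nonneg x) x
  · intro x y θ hθ hθ1
    have hθ1' : 0 < 1 - θ := by linarith
    by_cases hx : x ∈ interior {x | 0 < f x}
    · by_cases hy : y ∈ interior {x | 0 < f x}
      · rw [indicator_of_mem hx, indicator_of_mem hy,
          indicator_of_mem (hint hx hy hθ.le hθ1'.le (by ring))]
        exact hf.rpow_mul_rpow_le x y hθ hθ1
      · rw [indicator_of_notMem hy, Real.zero_rpow hθ1'.ne', mul_zero]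
        exact indicator_nonneg (fun x _ => hf.nonneg x) _
    · rw [indicator_of_notMem hx, Real.zero_rpow hθ.ne', zero_mul]
      exact indicator_nonneg (fun x _ => hf.nonneg x) _
  · have hcont : ContinuousOn f (interior {x | 0 < f x}) := by
      refine (hconc.continuousOn_interior.rexp).congr fun x hx => ?_
      exact (Real.exp_log (hfint x hx)).symm
    refine measurable_of_restrict_of_restrict_compl (s := interior {x | 0 < f x})
      isOpen_interior.measurableSet ?_ ?_
    · have : (interior {x | 0 < f x}).domRestrict ((interior {x | 0 < f x}).indicator f) =
          (interior {x | 0 < f x}).domRestrict f := by ext x; simp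
      rw [this]
      exact (continuousOn_iff_continuous_domRestrict.1 hcont).measurable
    · have : (interior {x | 0 < f x})ᶜ.domRestrict ((interior {x | 0 < f x}).indicator f) =
          fun _ => 0 := by ext x; exact indicator_of_notMem x.2 _
      rw [this]
      exact measurable_const
  · have hnull := hconv.addHaar_frontier volume
    filter_upwards [measure_eq_zero_iff_ae_notMem.1 hnull] with x hx
    by_cases hxi : x ∈ interior {x | 0 < f x}
    · rw [indicator_of_mem hxi]
    · rw [indicator_of_notMem hxi]
      by_contra hne
      exact hx ⟨subset_closure (lt_of_le_of_ne (hf.nonneg x) hne), hxi⟩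

theorem norm_sq_convex_combination_le {V : Type*} [SeminormedAddCommGroup V] [NormedSpace ℝ V]
    (x y : V) {θ : ℝ} (h0 : 0 ≤ θ) (h1 : θ ≤ 1) :
    ‖θ • x + (1 - θ) • y‖ ^ 2 ≤ θ * ‖x‖ ^ 2 + (1 - θ) * ‖y‖ ^ 2 := by
  have h : ‖θ • x + (1 - θ) • y‖ ≤ θ * ‖x‖ + (1 - θ) * ‖y‖ := by
    refine (norm_add_le _ _).trans_eq ?_
    rw [norm_smul, norm_smul, Real.norm_of_nonneg h0, Real.norm_of_nonneg (sub_nonneg.2 h1)]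
  refine (pow_le_pow_left₀ (norm_nonneg _) h 2).trans ?_
  nlinarith [mul_nonneg (mul_nonneg h0 (sub_nonneg.2 h1)) (sq_nonneg (‖x‖ - ‖y‖))]

theorem gaussDensity_pos {d : ℕ} {v : ℝ} (hv : 0 < v) (x : E d) : 0 < gaussDensity d v x := by
  unfold gaussDensity; positivity

theorem isLogConcaveFun_gaussDensity (d : ℕ) {v : ℝ} (hv : 0 < v) :
    IsLogConcaveFun (gaussDensity d v) := by
  refine isLogConcaveFun_iff.2 ⟨fun x => (gaussDensity_pos hv x).le, fun x y θ h0 h1 => ?_⟩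
  unfold gaussDensity
  set c := (2 * Real.pi * v) ^ (-(d : ℝ) / 2) with hc
  have hc0 : 0 < c := by positivity
  rw [Real.mul_rpow hc0.le (Real.exp_pos _).le, Real.mul_rpow hc0.le (Real.exp_pos _).le,
    mul_mul_mul_comm, ← Real.rpow_add hc0, add_sub_cancel, Real.rpow_one, ← Real.exp_mul,
    ← Real.exp_mul, ← Real.exp_add]
  gcongr
  have h := norm_sq_convex_combination_le x y h0.le h1.le
  calc -‖x‖ ^ 2 / (2 * v) * θ + -‖y‖ ^ 2 / (2 * v) * (1 - θ)
      = -(θ * ‖x‖ ^ 2 + (1 - θ) * ‖y‖ ^ 2) / (2 * v) := by ring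
    _ ≤ -‖θ • x + (1 - θ) • y‖ ^ 2 / (2 * v) := by gcongr

/-- Prékopa's theorem for a log-concave function of `x` and a linear function of `(x, z)`. -/
theorem IsLogConcaveFun.integral_mul_comp {d : ℕ} {f g : E d → ℝ} (hf : IsLogConcaveFun f)
    (hg : IsLogConcaveFun g) (hfm : Measurable f) (hgm : Measurable g) (L : E d × E d →ₗ[ℝ] E d)
    (hL : ∀ z, Measurable fun x => L (x, z)) (hint : ∀ z, Integrable fun x => f x * g (L (x, z))) :
    IsLogConcaveFun fun z => ∫ x, f x * g (L (x, z)) := by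
  have h0 : ∀ z x, 0 ≤ f x * g (L (x, z)) := fun z x => mul_nonneg (hf.nonneg _) (hg.nonneg _)
  refine isLogConcaveFun_iff.2 ⟨fun z => integral_nonneg (h0 z), fun z w θ hθ hθ1 => ?_⟩
  have hθ1' : 0 < 1 - θ := by linarith
  have hmeas : ∀ z, Measurable fun x => ENNReal.ofReal (f x * g (L (x, z))) := fun z =>
    (hfm.mul (hgm.comp (hL z))).ennreal_ofReal
  have key := prekopaLeindler_euclideanSpace d θ hθ hθ1 _ _ _ (hmeas z) (hmeas w)
    (hmeas (θ • z + (1 - θ) • w)) fun x y => ?_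
  · rw [← ofReal_integral_eq_lintegral_ofReal (hint _) (.of_forall (h0 _)),
      ← ofReal_integral_eq_lintegral_ofReal (hint _) (.of_forall (h0 _)),
      ← ofReal_integral_eq_lintegral_ofReal (hint _) (.of_forall (h0 _)),
      ENNReal.ofReal_rpow_of_nonneg (integral_nonneg (h0 _)) hθ.le,
      ENNReal.ofReal_rpow_of_nonneg (integral_nonneg (h0 _)) hθ1'.le,
      ← ENNReal.ofReal_mul (Real.rpow_nonneg (integral_nonneg (h0 _)) _)] at key
    exact (ENNReal.ofReal_le_ofReal_iff (integral_nonneg (h0 _))).1 key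
  · rw [ENNReal.ofReal_rpow_of_nonneg (h0 _ _) hθ.le, ENNReal.ofReal_rpow_of_nonneg (h0 _ _) hθ1'.le,
      ← ENNReal.ofReal_mul (Real.rpow_nonneg (h0 _ _) _)]
    refine ENNReal.ofReal_le_ofReal ?_
    have hLe : L (θ • x + (1 - θ) • y, θ • z + (1 - θ) • w) =
        θ • L (x, z) + (1 - θ) • L (y, w) := by
      rw [← map_smul, ← map_smul, ← map_add]; rfl
    rw [Real.mul_rpow (hf.nonneg _) (hg.nonneg _), Real.mul_rpow (hf.nonneg _) (hg.nonneg _),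
      mul_mul_mul_comm, hLe]
    exact mul_le_mul (hf.rpow_mul_rpow_le x y hθ hθ1) (hg.rpow_mul_rpow_le _ _ hθ hθ1)
      (mul_nonneg (Real.rpow_nonneg (hg.nonneg _) _) (Real.rpow_nonneg (hg.nonneg _) _))
      (hf.nonneg _)

/-! ### Densities -/

theorem IsDensity.integrable {d : ℕ} {p : E d → ℝ} (hp : IsDensity p) : Integrable p := by
  refine ⟨hp.aemeasurable.aestronglyMeasurable, ?_⟩
  rw [hasFiniteIntegral_iff_ofReal (.of_forall hp.nonneg), hp.lintegral_eq_one]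
  exact ENNReal.one_lt_top

theorem IsDensity.congr {d : ℕ} {p p' : E d → ℝ} (hp : IsDensity p) (h : p =ᵐ[volume] p')
    (h0 : ∀ x, 0 ≤ p' x) : IsDensity p' where
  aemeasurable := hp.aemeasurable.congr h
  nonneg := h0
  lintegral_eq_one := by
    rw [← hp.lintegral_eq_one]
    refine lintegral_congr_ae ?_
    filter_upwards [h] with x hx using by rw [hx]

theorem HasDensity.congr {Ω : Type*} [MeasurableSpace Ω] {d : ℕ} {P : Measure Ω} {X : Ω → E d}
    {p p' : E d → ℝ} (hp : HasDensity P X p) (h : p =ᵐ[volume] p') (h0 : ∀ x, 0 ≤ p' x) :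
    HasDensity P X p' where
  isDensity := hp.isDensity.congr h h0
  hasLaw := by
    rw [← withDensity_congr_ae (f := fun x => ENNReal.ofReal (p x))]
    · exact hp.hasLaw
    · filter_upwards [h] with x hx using by rw [hx]

theorem HasDensity.exists_measurable {Ω : Type*} [MeasurableSpace Ω] {d : ℕ} {P : Measure Ω}
    {X : Ω → E d} {p : E d → ℝ} (hp : HasDensity P X p) :
    ∃ p', Measurable p' ∧ p =ᵐ[volume] p' ∧ HasDensity P X p' := by
  have h : p =ᵐ[volume] fun x => max (hp.isDensity.aemeasurable.mk p x) 0 := by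
    filter_upwards [hp.isDensity.aemeasurable.ae_eq_mk] with x hx
    rw [← hx, max_eq_left (hp.isDensity.nonneg x)]
  exact ⟨_, hp.isDensity.aemeasurable.measurable_mk.max measurable_const, h,
    hp.congr h fun x => le_max_right _ _⟩

theorem continuous_gaussDensity (d : ℕ) (v : ℝ) : Continuous (gaussDensity d v) := by
  unfold gaussDensity; fun_prop

theorem gaussDensity_le {d : ℕ} {v : ℝ} (hv : 0 < v) (x : E d) :
    gaussDensity d v x ≤ (2 * Real.pi * v) ^ (-(d : ℝ) / 2) := by
  unfold gaussDensity
  refine mul_le_of_le_one_right (by positivity) (Real.exp_le_one_iff.2 ?_)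
  exact div_nonpos_of_nonpos_of_nonneg (by simp) (by positivity)

theorem isDensity_gaussDensity (d : ℕ) {v : ℝ} (hv : 0 < v) : IsDensity (gaussDensity d v) where
  aemeasurable := (continuous_gaussDensity d v).aemeasurable
  nonneg x := (gaussDensity_pos hv x).le
  lintegral_eq_one := by
    have hb : 0 < (2 * v)⁻¹ := by positivity
    have hI : Integrable fun x : E d => Real.exp (-(2 * v)⁻¹ * ‖x‖ ^ 2) := by
      -- The Bochner integral of a non-integrable function is zero by convention, so a nonzero value
      -- proves integrability.
      refine Integrable.of_integral_ne_zero ?_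
      rw [GaussianFourier.integral_rexp_neg_mul_sq_norm hb]
      positivity
    have hg : gaussDensity d v = fun x =>
        (2 * Real.pi * v) ^ (-(d : ℝ) / 2) * Real.exp (-(2 * v)⁻¹ * ‖x‖ ^ 2) := by
      ext x; rw [gaussDensity]; congr 2; ring
    have h1 : ∫ x, gaussDensity d v x = 1 := by
      rw [hg, integral_const_mul, GaussianFourier.integral_rexp_neg_mul_sq_norm hb,
        finrank_euclideanSpace_fin, div_inv_eq_mul, neg_div, Real.rpow_neg (by positivity),
        show Real.pi * (2 * v) = 2 * Real.pi * v by ring]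
      exact inv_mul_cancel₀ (by positivity)
    rw [← ofReal_integral_eq_lintegral_ofReal (by rw [hg]; exact hI.const_mul _)
      (.of_forall fun x => (gaussDensity_pos hv x).le), h1, ENNReal.ofReal_one]

theorem IsDensity.isProbabilityMeasure {d : ℕ} {p : E d → ℝ} (hp : IsDensity p) :
    IsProbabilityMeasure (volume.withDensity fun x => ENNReal.ofReal (p x)) :=
  ⟨by rw [withDensity_apply _ MeasurableSet.univ, setLIntegral_univ, hp.lintegral_eq_one]⟩

/-- Both sides are probability measures with characteristic function `exp (-σ²‖t‖²/2)`. -/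
theorem stdGaussian_map_smul (d : ℕ) {σ : ℝ} (hσ : 0 < σ) :
    (stdGaussian (E d)).map (fun x => σ • x) =
      volume.withDensity fun x => ENNReal.ofReal (gaussDensity d (σ ^ 2) x) := by
  have hv : 0 < σ ^ 2 := by positivity
  have := (isDensity_gaussDensity d hv).isProbabilityMeasure
  have : IsProbabilityMeasure ((stdGaussian (E d)).map fun x => σ • x) :=
    Measure.isProbabilityMeasure_map (by fun_prop)
  refine Measure.ext_of_charFun ?_
  ext t
  rw [charFun_map_smul, charFun_stdGaussian, charFun_apply,
    integral_withDensity_eq_integral_toReal_smul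
      (continuous_gaussDensity d _).measurable.ennreal_ofReal (.of_forall fun _ => by simp)]
  have hb : 0 < ((2 * (σ : ℂ) ^ 2)⁻¹).re := by
    rw [show (2 * (σ : ℂ) ^ 2)⁻¹ = (((2 * σ ^ 2)⁻¹ : ℝ) : ℂ) by push_cast; rfl, Complex.ofReal_re]
    positivity
  have key := GaussianFourier.integral_cexp_neg_mul_sq_norm_add hb Complex.I t
  have hpt : ∀ x : E d, (ENNReal.ofReal (gaussDensity d (σ ^ 2) x)).toReal •
      Complex.exp (inner ℝ x t * Complex.I) = ((2 * Real.pi * σ ^ 2 : ℝ) ^ (-(d : ℝ) / 2) : ℝ) *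
        Complex.exp (-(2 * (σ : ℂ) ^ 2)⁻¹ * ‖x‖ ^ 2 + Complex.I * inner ℝ t x) := by
    intro x
    rw [ENNReal.toReal_ofReal (gaussDensity_pos hv x).le, gaussDensity, Complex.real_smul,
      Complex.ofReal_mul, mul_assoc, Complex.ofReal_exp, ← Complex.exp_add, real_inner_comm]
    congr 2
    push_cast
    ring
  simp_rw [hpt]
  rw [integral_const_mul, key, finrank_euclideanSpace_fin, div_inv_eq_mul]
  have h1 : ((Real.pi : ℂ) * (2 * (σ : ℂ) ^ 2)) ^ ((d : ℂ) / 2) =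
      (((2 * Real.pi * σ ^ 2 : ℝ) ^ ((d : ℝ) / 2) : ℝ) : ℂ) := by
    rw [Complex.ofReal_cpow (by positivity)]
    push_cast
    ring_nf
  rw [h1, ← mul_assoc, ← Complex.ofReal_mul, ← Real.rpow_add (by positivity),
    show -(d : ℝ) / 2 + d / 2 = 0 by ring, Real.rpow_zero, Complex.ofReal_one, one_mul]
  congr 1
  rw [norm_smul, Real.norm_of_nonneg hσ.le, Complex.I_sq]
  have : (σ : ℂ) ≠ 0 := by exact_mod_cast hσ.ne'
  push_cast
  field_simp
  ring

theorem hasDensity_smul_of_stdGaussian {Ω : Type*} [MeasurableSpace Ω] {P : Measure Ω} {d : ℕ}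
    {G : Ω → E d} (hG : HasLaw G (stdGaussian (E d)) P) {σ : ℝ} (hσ : 0 < σ) :
    HasDensity P (fun a => σ • G a) (gaussDensity d (σ ^ 2)) where
  isDensity := isDensity_gaussDensity d (by positivity)
  hasLaw := ⟨hG.aemeasurable.const_smul σ, by
    rw [← stdGaussian_map_smul d hσ, ← hG.map_eq,
      AEMeasurable.map_map_of_aemeasurable (by fun_prop) hG.aemeasurable]
    rfl⟩

/-! ### The density of the convolution with a Gaussian -/

/-- The convolution of `p` with the centred Gaussian density of covariance `v I`. -/
noncomputable def gaussConv {d : ℕ} (p : E d → ℝ) (v : ℝ) (z : E d) : ℝ :=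
  ∫ u, p (z - u) * gaussDensity d v u

theorem gaussConv_eq_integral_mul_sub {d : ℕ} (p : E d → ℝ) (v : ℝ) (z : E d) :
    gaussConv p v z = ∫ x, p x * gaussDensity d v (z - x) := by
  rw [gaussConv, ← integral_sub_left_eq_self _ volume z]
  simp

theorem ae_eq_comp_sub_left {d : ℕ} {p p' : E d → ℝ} (h : p =ᵐ[volume] p') (z : E d) :
    (fun u => p (z - u)) =ᵐ[volume] fun u => p' (z - u) :=
  (volume.measurePreserving_sub_left z).quasiMeasurePreserving.ae_eq_comp h

theorem gaussConv_congr {d : ℕ} {p p' : E d → ℝ} (h : p =ᵐ[volume] p') (v : ℝ) :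
    gaussConv p v = gaussConv p' v := by
  ext z
  refine integral_congr_ae ?_
  filter_upwards [ae_eq_comp_sub_left h z] with u hu
  simp only [hu]

theorem condLawSummand_gaussDensity {d : ℕ} (p : E d → ℝ) (v : ℝ) (z : E d) :
    condLawSummand p (gaussDensity d v) z = volume.withDensity fun u =>
      ENNReal.ofReal (p (z - u) * gaussDensity d v u / gaussConv p v z) :=
  rfl

/-- Valid for every `z`, since `u ↦ z - u` preserves null sets. Thus `p` can be replaced by a Borel
version without altering any of the measures `κ_z`. -/
theorem condLawSummand_congr {d : ℕ} {p p' : E d → ℝ} (h : p =ᵐ[volume] p') (v : ℝ) (z : E d) :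
    condLawSummand p (gaussDensity d v) z = condLawSummand p' (gaussDensity d v) z := by
  rw [condLawSummand_gaussDensity, condLawSummand_gaussDensity, gaussConv_congr h]
  refine withDensity_congr_ae ?_
  filter_upwards [ae_eq_comp_sub_left h z] with u hu
  rw [hu]

theorem integrable_comp_sub_mul_gaussDensity {d : ℕ} {p : E d → ℝ} (hp : Integrable p) {v : ℝ}
    (hv : 0 < v) (z : E d) : Integrable fun u => p (z - u) * gaussDensity d v u := by
  refine (hp.comp_sub_left z).mul_bdd (c := (2 * Real.pi * v) ^ (-(d : ℝ) / 2))
    (continuous_gaussDensity d v).aestronglyMeasurable (.of_forall fun u => ?_)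
  rw [Real.norm_of_nonneg (gaussDensity_pos hv u).le]
  exact gaussDensity_le hv u

/-- As the Gaussian never vanishes, a zero integral would force `p (z - u) = 0` for almost every
`u`, against total mass 1. -/
theorem gaussConv_pos {d : ℕ} {p : E d → ℝ} (hp : IsDensity p) {v : ℝ} (hv : 0 < v) (z : E d) :
    0 < gaussConv p v z := by
  have h0 : ∀ u, 0 ≤ p (z - u) * gaussDensity d v u := fun u =>
    mul_nonneg (hp.nonneg _) (gaussDensity_pos hv u).le
  refine (integral_nonneg h0).lt_of_ne' fun h => ?_
  rw [integral_eq_zero_iff_of_nonneg h0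
    (integrable_comp_sub_mul_gaussDensity hp.integrable hv z)] at h
  have h1 : ∫⁻ u, ENNReal.ofReal (p (z - u)) = 1 := by
    rw [lintegral_sub_left_eq_self (fun x => ENNReal.ofReal (p x)) z, hp.lintegral_eq_one]
  have h2 : ∫⁻ u, ENNReal.ofReal (p (z - u)) = 0 := by
    rw [← lintegral_zero]
    refine lintegral_congr_ae ?_
    filter_upwards [h] with u hu
    rcases mul_eq_zero.1 hu with hu | hu
    · simp [hu]
    · exact absurd hu (gaussDensity_pos hv u).ne'
  rw [h1] at h2
  exact one_ne_zero h2

theorem isProbabilityMeasure_condLawSummand {d : ℕ} {p : E d → ℝ} (hp : IsDensity p) {v : ℝ}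
    (hv : 0 < v) (z : E d) : IsProbabilityMeasure (condLawSummand p (gaussDensity d v) z) := by
  have hc := gaussConv_pos hp hv z
  refine ⟨?_⟩
  rw [condLawSummand_gaussDensity, withDensity_apply _ MeasurableSet.univ, setLIntegral_univ,
    ← ofReal_integral_eq_lintegral_ofReal
      ((integrable_comp_sub_mul_gaussDensity hp.integrable hv z).div_const _)
      (.of_forall fun u => div_nonneg (mul_nonneg (hp.nonneg _) (gaussDensity_pos hv u).le) hc.le),
    integral_div]
  change ENNReal.ofReal (gaussConv p v z / gaussConv p v z) = 1
  rw [div_self hc.ne', ENNReal.ofReal_one]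

/-- This bound gives `κ_z` a first moment and dominates the gradient of the Gaussian, with no moment
assumption on `p`. The constant comes from `s ≤ 1 + s²` and `1 + x ≤ exp x` at `x = s²/(2v)`. -/
theorem norm_mul_gaussDensity_le {d : ℕ} {v : ℝ} (hv : 0 < v) (u : E d) :
    ‖u‖ * gaussDensity d v u ≤ (1 + 2 * v) * (2 * Real.pi * v) ^ (-(d : ℝ) / 2) := by
  unfold gaussDensity
  set c := (2 * Real.pi * v) ^ (-(d : ℝ) / 2)
  have hc : 0 < c := by positivity
  have h1 : ‖u‖ * Real.exp (-‖u‖ ^ 2 / (2 * v)) ≤ 1 + 2 * v := by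
    have h2 := Real.add_one_le_exp (‖u‖ ^ 2 / (2 * v))
    rw [neg_div, Real.exp_neg, ← div_eq_mul_inv, div_le_iff₀ (Real.exp_pos _)]
    calc ‖u‖ ≤ 1 + ‖u‖ ^ 2 := by nlinarith [sq_nonneg (‖u‖ - 1)]
      _ ≤ (1 + 2 * v) * (‖u‖ ^ 2 / (2 * v) + 1) := by
          have h3 : 0 ≤ ‖u‖ ^ 2 / (2 * v) := by positivity
          have h4 : 2 * v * (‖u‖ ^ 2 / (2 * v)) = ‖u‖ ^ 2 := by field_simp
          nlinarith
      _ ≤ _ := by gcongr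
  calc ‖u‖ * (c * Real.exp (-‖u‖ ^ 2 / (2 * v))) = ‖u‖ * Real.exp (-‖u‖ ^ 2 / (2 * v)) * c := by
        ring
    _ ≤ _ := by gcongr

theorem integrable_comp_sub_mul_gaussDensity_smul {d : ℕ} {p : E d → ℝ} (hp : Integrable p)
    {v : ℝ} (hv : 0 < v) (z : E d) :
    Integrable fun u => (p (z - u) * gaussDensity d v u) • u := by
  have h := (hp.comp_sub_left z).smul_bdd (f := fun u => gaussDensity d v u • u)
    ((1 + 2 * v) * (2 * Real.pi * v) ^ (-(d : ℝ) / 2))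
    ((continuous_gaussDensity d v).smul continuous_id).aestronglyMeasurable
    (.of_forall fun u => by
      rw [norm_smul, Real.norm_of_nonneg (gaussDensity_pos hv u).le, mul_comm]
      exact norm_mul_gaussDensity_le hv u)
  refine h.congr (.of_forall fun u => ?_)
  exact smul_smul (p (z - u)) (gaussDensity d v u) u

theorem integrable_condLawSummand_iff {d : ℕ} {p : E d → ℝ} (hp : IsDensity p) {v : ℝ}
    (hv : 0 < v) (z : E d) {F : Type*} [NormedAddCommGroup F] [NormedSpace ℝ F] {f : E d → F} :
    Integrable f (condLawSummand p (gaussDensity d v) z) ↔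
      Integrable fun u => (p (z - u) * gaussDensity d v u) • f u := by
  have hc := gaussConv_pos hp hv z
  have hint := (integrable_comp_sub_mul_gaussDensity hp.integrable hv z)
  rw [condLawSummand_gaussDensity, integrable_withDensity_iff_integrable_smul₀']
  · have h : (fun u => (ENNReal.ofReal (p (z - u) * gaussDensity d v u /
        gaussConv p v z)).toReal • f u) =
        fun u => (gaussConv p v z)⁻¹ • ((p (z - u) * gaussDensity d v u) • f u) := by
      ext1 u
      rw [ENNReal.toReal_ofReal (div_nonneg (mul_nonneg (hp.nonneg _)
        (gaussDensity_pos hv u).le) hc.le), smul_smul, div_eq_inv_mul]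
    rw [h, integrable_fun_smul_iff (inv_ne_zero hc.ne')]
  · exact (hint.aemeasurable.div_const _).ennreal_ofReal
  · exact .of_forall fun _ => ENNReal.ofReal_lt_top

theorem integral_condLawSummand {d : ℕ} {p : E d → ℝ} (hp : IsDensity p) {v : ℝ}
    (hv : 0 < v) (z : E d) {F : Type*} [NormedAddCommGroup F] [NormedSpace ℝ F] (f : E d → F) :
    ∫ u, f u ∂condLawSummand p (gaussDensity d v) z =
      (gaussConv p v z)⁻¹ • ∫ u, (p (z - u) * gaussDensity d v u) • f u := by
  have hc := gaussConv_pos hp hv z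
  have hint := (integrable_comp_sub_mul_gaussDensity hp.integrable hv z)
  rw [condLawSummand_gaussDensity, integral_withDensity_eq_integral_toReal_smul₀, ← integral_smul]
  · congr 1
    ext1 u
    rw [ENNReal.toReal_ofReal (div_nonneg (mul_nonneg (hp.nonneg _)
        (gaussDensity_pos hv u).le) hc.le), smul_smul, div_eq_inv_mul]
  · exact (hint.aemeasurable.div_const _).ennreal_ofReal
  · exact .of_forall fun _ => ENNReal.ofReal_lt_top

/-- By independence and Tonelli, translating by `u` in the first variable shows that `(X + W, W)`
has joint density `p (z - u) * q u`. Both the law of the sum and its conditional kernel are read off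
from this. -/
theorem lintegral_prodMk_add {Ω : Type*} [MeasurableSpace Ω] {P : Measure Ω}
    [IsProbabilityMeasure P] {d : ℕ} {X W : Ω → E d} {p q : E d → ℝ} (hX : HasDensity P X p)
    (hW : HasDensity P W q) (hXW : IndepFun X W P) (hp : Measurable p) (hq : Measurable q)
    {F : E d × E d → ENNReal} (hF : Measurable F) :
    ∫⁻ a, F (X a + W a, W a) ∂P =
      ∫⁻ z, ∫⁻ u, ENNReal.ofReal (p (z - u) * q u) * F (z, u) := by
  have := hX.isDensity.isProbabilityMeasure
  have := hW.isDensity.isProbabilityMeasure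
  have hmap := (indepFun_iff_map_prod_eq_prod_map_map hX.hasLaw.aemeasurable
    hW.hasLaw.aemeasurable).1 hXW
  have hF' : Measurable fun y : E d × E d => F (y.1 + y.2, y.2) := by fun_prop
  rw [← lintegral_map' (f := fun y : E d × E d => F (y.1 + y.2, y.2)) (g := fun a => (X a, W a))
    hF'.aemeasurable (hX.hasLaw.aemeasurable.prodMk hW.hasLaw.aemeasurable), hmap,
    hX.hasLaw.map_eq, hW.hasLaw.map_eq, lintegral_prod_symm _ hF'.aemeasurable,
    lintegral_withDensity_eq_lintegral_mul _ hq.ennreal_ofReal hF'.lintegral_prod_left',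
    lintegral_lintegral_swap (by fun_prop)]
  refine lintegral_congr fun u => ?_
  simp only [Pi.mul_apply]
  rw [lintegral_withDensity_eq_lintegral_mul _ hp.ennreal_ofReal (by fun_prop),
    ← lintegral_const_mul _ (by fun_prop),
    ← lintegral_sub_right_eq_self (μ := volume) _ u]
  refine lintegral_congr fun z => ?_
  simp only [Pi.mul_apply, sub_add_cancel]
  rw [ENNReal.ofReal_mul (hX.isDensity.nonneg _)]
  ring

theorem measurable_gaussConv {d : ℕ} {p : E d → ℝ} (hp : AEMeasurable p) (v : ℝ) :
    Measurable (gaussConv p v) := by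
  rw [gaussConv_congr hp.ae_eq_mk]
  have hm := hp.measurable_mk
  have hq := (continuous_gaussDensity d v).measurable
  have : StronglyMeasurable (Function.uncurry fun z u : E d =>
      hp.mk p (z - u) * gaussDensity d v u) :=
    Measurable.stronglyMeasurable (by unfold Function.uncurry; fun_prop)
  exact this.integral_prod_right.measurable

theorem ofReal_gaussConv {d : ℕ} {p : E d → ℝ} (hp : IsDensity p) {v : ℝ} (hv : 0 < v) (z : E d) :
    ENNReal.ofReal (gaussConv p v z) = ∫⁻ u, ENNReal.ofReal (p (z - u) * gaussDensity d v u) :=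
  ofReal_integral_eq_lintegral_ofReal (integrable_comp_sub_mul_gaussDensity hp.integrable hv z)
    (.of_forall fun u => mul_nonneg (hp.nonneg _) (gaussDensity_pos hv u).le)

theorem HasDensity.add_gauss {Ω : Type*} [MeasurableSpace Ω] {P : Measure Ω}
    [IsProbabilityMeasure P] {d : ℕ} {X W : Ω → E d} {p : E d → ℝ} {v : ℝ} (hv : 0 < v)
    (hX : HasDensity P X p) (hW : HasDensity P W (gaussDensity d v)) (hXW : IndepFun X W P) :
    HasDensity P (fun a => X a + W a) (gaussConv p v) := by
  obtain ⟨p', hp', hpp', hX'⟩ := hX.exists_measurable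
  rw [gaussConv_congr hpp']
  have hm := measurable_gaussConv hp'.aemeasurable v
  have hmeas : AEMeasurable (fun a => X a + W a) P :=
    hX.hasLaw.aemeasurable.add hW.hasLaw.aemeasurable
  have hmap : P.map (fun a => X a + W a) =
      volume.withDensity fun x => ENNReal.ofReal (gaussConv p' v x) := by
    ext B hB
    rw [withDensity_apply _ hB, ← lintegral_indicator_one hB,
      lintegral_map' (by fun_prop (disch := assumption)) hmeas]
    have key := lintegral_prodMk_add hX' hW hXW hp' (continuous_gaussDensity d v).measurable
      (F := fun y => B.indicator 1 y.1) ((measurable_one.indicator hB).comp measurable_fst)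
    rw [key, ← lintegral_indicator hB]
    refine lintegral_congr fun z => ?_
    by_cases hz : z ∈ B
    · simp [hz, ofReal_gaussConv hX'.isDensity hv]
    · simp [hz]
  refine ⟨⟨hm.aemeasurable, fun z => (gaussConv_pos hX'.isDensity hv z).le, ?_⟩, hmeas, hmap⟩
  have : IsProbabilityMeasure (P.map fun a => X a + W a) := Measure.isProbabilityMeasure_map hmeas
  rw [← setLIntegral_univ, ← withDensity_apply _ MeasurableSet.univ, ← hmap, measure_univ]

/-- The joint density factors as `gaussConv p v z` times the density of `κ_z`; conditional
distributions are almost everywhere unique. -/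
theorem condDistrib_add_gauss {Ω : Type*} [MeasurableSpace Ω] {P : Measure Ω}
    [IsProbabilityMeasure P] {d : ℕ} {X W : Ω → E d} {p : E d → ℝ} {v : ℝ} (hv : 0 < v)
    (hX : HasDensity P X p) (hW : HasDensity P W (gaussDensity d v)) (hXW : IndepFun X W P) :
    ∀ᵐ z ∂P.map fun a => X a + W a, condDistrib W (fun a => X a + W a) P z =
      condLawSummand p (gaussDensity d v) z := by
  obtain ⟨p', hp', hpp', hX'⟩ := hX.exists_measurable
  simp_rw [condLawSummand_congr hpp']
  have hm := measurable_gaussConv hp'.aemeasurable v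
  have hq := (continuous_gaussDensity d v).measurable
  have hZ := hX'.add_gauss hv hW hXW
  have hk : Measurable (Function.uncurry fun z u : E d =>
      ENNReal.ofReal (p' (z - u) * gaussDensity d v u / gaussConv p' v z)) := by
    unfold Function.uncurry; fun_prop
  let κ : Kernel (E d) (E d) := Kernel.withDensity (Kernel.const (E d) volume) fun z u =>
      ENNReal.ofReal (p' (z - u) * gaussDensity d v u / gaussConv p' v z)
  have hκ : ∀ z, κ z = condLawSummand p' (gaussDensity d v) z := fun z => by
    simp only [κ]
    rw [Kernel.withDensity_apply _ hk, Kernel.const_apply, condLawSummand_gaussDensity]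
  have : IsMarkovKernel κ := ⟨fun z => by
    rw [hκ]; exact isProbabilityMeasure_condLawSummand hX'.isDensity hv z⟩
  have hmW : AEMeasurable (fun a => (X a + W a, W a)) P :=
    (hX.hasLaw.aemeasurable.add hW.hasLaw.aemeasurable).prodMk hW.hasLaw.aemeasurable
  have key := condDistrib_ae_eq_of_measure_eq_compProd (μ := P) (fun a => X a + W a)
    hW.hasLaw.aemeasurable (κ := κ) ?_
  · filter_upwards [key] with z hz
    rw [hz, hκ]
  · ext B hB
    have hF : Measurable (B.indicator (1 : E d × E d → ENNReal)) := measurable_one.indicator hB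
    rw [← lintegral_indicator_one hB, ← lintegral_indicator_one hB,
      lintegral_map' hF.aemeasurable hmW, Measure.lintegral_compProd hF, hZ.hasLaw.map_eq,
      lintegral_withDensity_eq_lintegral_mul _ hm.ennreal_ofReal hF.lintegral_kernel_prod_right',
      lintegral_prodMk_add hX' hW hXW hp' hq hF]
    refine lintegral_congr fun z => ?_
    have hc := gaussConv_pos hX'.isDensity hv z
    have hFz : Measurable fun u => B.indicator (1 : E d × E d → ENNReal) (z, u) :=
      hF.comp measurable_prodMk_left
    rw [Pi.mul_apply, Kernel.lintegral_withDensity _ hk _ hFz, Kernel.const_apply,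
      ← lintegral_const_mul _ (by fun_prop)]
    refine lintegral_congr fun u => ?_
    rw [← mul_assoc, ← ENNReal.ofReal_mul hc.le, mul_div_cancel₀ _ hc.ne']

/-! ### Smoothness and score -/

theorem exp_inner_mul_norm_le {V : Type*} [NormedAddCommGroup V] [InnerProductSpace ℝ V]
    (x w : V) {c : ℝ} (hc : ‖w‖ + 1 ≤ c) :
    Real.exp (inner ℝ x w) * ‖x‖ ≤ Real.exp (c * ‖x‖) := by
  have h1 : ‖x‖ ≤ Real.exp ‖x‖ := by linarith [Real.add_one_le_exp ‖x‖]
  have h2 : inner ℝ x w + ‖x‖ ≤ c * ‖x‖ := by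
    nlinarith [real_inner_le_norm x w, norm_nonneg x]
  calc Real.exp (inner ℝ x w) * ‖x‖ ≤ Real.exp (inner ℝ x w) * Real.exp ‖x‖ :=
        mul_le_mul_of_nonneg_left h1 (Real.exp_pos _).le
    _ = Real.exp (inner ℝ x w + ‖x‖) := (Real.exp_add _ _).symm
    _ ≤ Real.exp (c * ‖x‖) := Real.exp_le_exp.2 h2

theorem hasFDerivAt_exp_inner_smul {V F : Type*} [NormedAddCommGroup V] [InnerProductSpace ℝ V]
    [NormedAddCommGroup F] [NormedSpace ℝ F] (x w : V) (y : F) :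
    HasFDerivAt (fun z => Real.exp (inner ℝ x z) • y)
      (Real.exp (inner ℝ x w) • (innerSL ℝ x).smulRight y) w := by
  have h1 : HasFDerivAt (fun z => inner ℝ x z) (innerSL ℝ x) w := (innerSL ℝ x).hasFDerivAt
  have h2 : HasFDerivAt (fun z => Real.exp (inner ℝ x z))
      (Real.exp (inner ℝ x w) • innerSL ℝ x) w := h1.exp
  refine (h2.smul_const y).congr_fderiv ?_
  ext z
  simp [smul_smul]

/-- Differentiation under the integral, dominated on the unit ball around `z`. With vector-valued
`ψ` the derivative is an integral of the same kind, for `⟨x, ·⟩ ψ x`, which is what lets the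
smoothness proof iterate. -/
theorem hasFDerivAt_integral_exp_inner_smul {d : ℕ} {F : Type*} [NormedAddCommGroup F]
    [NormedSpace ℝ F] {μ : Measure (E d)} {ψ : E d → F} (hψ : AEStronglyMeasurable ψ μ)
    (hint : ∀ c : ℝ, Integrable (fun x => Real.exp (c * ‖x‖) * ‖ψ x‖) μ) (z : E d) :
    HasFDerivAt (fun z => ∫ x, Real.exp (inner ℝ x z) • ψ x ∂μ)
      (∫ x, Real.exp (inner ℝ x z) • (innerSL ℝ x).smulRight (ψ x) ∂μ) z := by
  have hexp : ∀ w : E d, Continuous fun x : E d => Real.exp (inner ℝ x w) := fun w => by fun_prop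
  have hle : ∀ x w : E d, Real.exp (inner ℝ x w) ≤ Real.exp (‖w‖ * ‖x‖) := fun x w =>
    Real.exp_le_exp.2 ((real_inner_le_norm x w).trans_eq (mul_comm _ _))
  refine hasFDerivAt_integral_of_dominated_of_fderiv_le (𝕜 := ℝ) (s := Metric.ball z 1)
    (F := fun z x => Real.exp (inner ℝ x z) • ψ x)
    (F' := fun z x => Real.exp (inner ℝ x z) • (innerSL ℝ x).smulRight (ψ x))
    (bound := fun x => Real.exp ((‖z‖ + 2) * ‖x‖) * ‖ψ x‖)
    (Metric.ball_mem_nhds z one_pos) (.of_forall fun w => ?_) ?_ ?_ (.of_forall fun x w hw => ?_)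
    (hint _) (.of_forall fun x w hw => ?_)
  · exact (hexp w).aestronglyMeasurable.smul hψ
  · refine (hint ‖z‖).mono' ((hexp z).aestronglyMeasurable.smul hψ) (.of_forall fun x => ?_)
    rw [norm_smul, Real.norm_of_nonneg (Real.exp_pos _).le]
    exact mul_le_mul_of_nonneg_right (hle x z) (norm_nonneg _)
  · refine (hexp z).aestronglyMeasurable.smul ?_
    have h : Continuous fun y : (E d →L[ℝ] ℝ) × F => y.1.smulRight y.2 := by fun_prop
    exact h.comp_aestronglyMeasurable ((innerSL ℝ).continuous.aestronglyMeasurable.prodMk hψ)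
  · rw [norm_smul, Real.norm_of_nonneg (Real.exp_pos _).le, ContinuousLinearMap.norm_smulRight_apply,
      innerSL_apply_norm, ← mul_assoc]
    refine mul_le_mul_of_nonneg_right ?_ (norm_nonneg _)
    have hw' : ‖w‖ ≤ ‖z‖ + 1 := by
      have := norm_le_norm_add_norm_sub' w z
      have h2 := mem_ball_iff_norm.1 hw
      linarith
    exact exp_inner_mul_norm_le x w (by linarith)
  · exact hasFDerivAt_exp_inner_smul x w (ψ x)

theorem contDiff_integral_exp_inner_smul {d : ℕ} (n : ℕ) {μ : Measure (E d)} {F : Type}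
    [NormedAddCommGroup F] [NormedSpace ℝ F] {ψ : E d → F} (hψ : AEStronglyMeasurable ψ μ)
    (hint : ∀ c : ℝ, Integrable (fun x => Real.exp (c * ‖x‖) * ‖ψ x‖) μ) :
    ContDiff ℝ n fun z => ∫ x, Real.exp (inner ℝ x z) • ψ x ∂μ := by
  induction n generalizing F with
  | zero =>
    exact contDiff_zero.2 (continuous_iff_continuousAt.2 fun z =>
      (hasFDerivAt_integral_exp_inner_smul hψ hint z).continuousAt)
  | succ n ih =>
    rw [show ((n + 1 : ℕ) : WithTop ℕ∞) = (n : WithTop ℕ∞) + 1 by norm_cast,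
      contDiff_succ_iff_hasFDerivAt]
    refine ⟨_, ih ?_ fun c => ?_, fun z => hasFDerivAt_integral_exp_inner_smul hψ hint z⟩
    · have h : Continuous fun y : (E d →L[ℝ] ℝ) × F => y.1.smulRight y.2 := by fun_prop
      exact h.comp_aestronglyMeasurable ((innerSL ℝ).continuous.aestronglyMeasurable.prodMk hψ)
    · have hm : AEStronglyMeasurable (fun x => Real.exp (c * ‖x‖)) μ :=
        Continuous.aestronglyMeasurable (by fun_prop)
      simp_rw [ContinuousLinearMap.norm_smulRight_apply, innerSL_apply_norm]
      -- The extra factor `‖x‖` produced by the derivative is absorbed by `‖x‖ ≤ exp ‖x‖`, at the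
      -- cost of raising `c` by one.
      refine (hint (c + 1)).mono' (hm.mul (continuous_norm.aestronglyMeasurable.mul hψ.norm))
        (.of_forall fun x => ?_)
      rw [Real.norm_of_nonneg (by positivity), ← mul_assoc]
      gcongr
      rw [add_mul, one_mul, Real.exp_add]
      gcongr
      linarith [Real.add_one_le_exp ‖x‖]

theorem gaussDensity_sub_eq {d : ℕ} {v : ℝ} (z x : E d) :
    gaussDensity d v (z - x) = gaussDensity d v z *
      (Real.exp (inner ℝ x (v⁻¹ • z)) * Real.exp (-‖x‖ ^ 2 / (2 * v))) := by
  rw [gaussDensity, gaussDensity]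
  generalize (2 * Real.pi * v) ^ (-(d : ℝ) / 2) = c
  rw [mul_assoc c, ← Real.exp_add, ← Real.exp_add, norm_sub_sq_real,
    inner_smul_right, real_inner_comm]
  congr 2
  by_cases hv : v = 0
  · simp [hv]
  · field_simp
    ring

theorem contDiff_gaussConv {d : ℕ} {p : E d → ℝ} (hp : Integrable p) {v : ℝ} (hv : 0 < v) :
    ContDiff ℝ ∞ (gaussConv p v) := by
  have hcont : Continuous fun x : E d => Real.exp (-‖x‖ ^ 2 / (2 * v)) := by fun_prop
  have hM : ContDiff ℝ ∞ fun z : E d =>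
      ∫ x, Real.exp (inner ℝ x z) • (Real.exp (-‖x‖ ^ 2 / (2 * v)) * p x) := by
    refine contDiff_infty.2 fun n => contDiff_integral_exp_inner_smul n
      (hcont.aestronglyMeasurable.mul hp.aestronglyMeasurable) fun c => ?_
    have hc : Continuous fun x : E d => Real.exp (c * ‖x‖) * Real.exp (-‖x‖ ^ 2 / (2 * v)) := by
      fun_prop
    -- Completing the square: `c‖x‖ - ‖x‖²/(2v)` is at most `v c²/2`, so every exponential moment is
    -- finite.
    refine (hp.norm.bdd_mul (c := Real.exp (v * c ^ 2 / 2)) hc.aestronglyMeasurable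
      (.of_forall fun x => ?_)).congr (.of_forall fun x => ?_)
    · rw [Real.norm_of_nonneg (by positivity), ← Real.exp_add, Real.exp_le_exp]
      have : v * c ^ 2 / 2 - (c * ‖x‖ + -‖x‖ ^ 2 / (2 * v)) = (v * c - ‖x‖) ^ 2 / (2 * v) := by
        field_simp
        ring
      have h2 : 0 ≤ (v * c - ‖x‖) ^ 2 / (2 * v) := by positivity
      linarith
    · simp [mul_assoc]
  have hq : ContDiff ℝ ∞ (gaussDensity d v) := by
    unfold gaussDensity
    exact contDiff_const.mul (((contDiff_norm_sq ℝ).neg.div_const _).exp)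
  have h : gaussConv p v = fun z => gaussDensity d v z *
      ∫ x, Real.exp (inner ℝ x (v⁻¹ • z)) • (Real.exp (-‖x‖ ^ 2 / (2 * v)) * p x) := by
    ext z
    rw [gaussConv_eq_integral_mul_sub, ← integral_const_mul]
    refine integral_congr_ae (.of_forall fun x => ?_)
    simp only [gaussDensity_sub_eq, smul_eq_mul]
    ring
  rw [h]
  exact hq.mul (hM.comp (contDiff_const_smul _))

theorem hasGradientAt_gaussDensity {d : ℕ} (v : ℝ) (x : E d) :
    HasGradientAt (gaussDensity d v) (-(v⁻¹ * gaussDensity d v x) • x) x := by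
  have h := (((hasStrictFDerivAt_norm_sq x).hasFDerivAt.fun_neg.mul_const
    (2 * v)⁻¹).exp.const_mul ((2 * Real.pi * v) ^ (-(d : ℝ) / 2)))
  rw [hasGradientAt_iff_hasFDerivAt]
  refine (h.congr_fderiv ?_).congr_of_eventuallyEq (.of_forall fun y => ?_)
  · ext w
    simp [gaussDensity, div_eq_mul_inv]
    ring
  · simp [gaussDensity, div_eq_mul_inv]

theorem HasGradientAt.neg_log {V : Type*} [NormedAddCommGroup V] [InnerProductSpace ℝ V]
    [CompleteSpace V] {f : V → ℝ} {g x : V} (h : HasGradientAt f g x) (hx : f x ≠ 0) :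
    HasGradientAt (fun y => -Real.log (f y)) (-((f x)⁻¹ • g)) x := by
  rw [hasGradientAt_iff_hasFDerivAt] at h ⊢
  refine (h.log hx).fun_neg.congr_fderiv ?_
  simp

theorem score_gaussDensity {d : ℕ} {v : ℝ} (hv : 0 < v) (x : E d) :
    score (gaussDensity d v) x = v⁻¹ • x := by
  have hq := (gaussDensity_pos hv x).ne'
  rw [score, (HasGradientAt.neg_log (hasGradientAt_gaussDensity v x) hq).gradient, smul_smul,
    ← neg_smul]
  congr 1
  field_simp

/-- The derivative falls on the Gaussian in `∫ p x * φ_v (z - x)`; its gradient is bounded uniformly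
in `z`, so `|p|` times a constant dominates. Substituting `u = z - x` gives the stated form. -/
theorem hasGradientAt_gaussConv {d : ℕ} {p : E d → ℝ} (hp : Integrable p) {v : ℝ} (hv : 0 < v)
    (z : E d) : HasGradientAt (gaussConv p v)
      (-v⁻¹ • ∫ u, (p (z - u) * gaussDensity d v u) • u) z := by
  have hq := continuous_gaussDensity d v
  have hqs : ∀ w, AEStronglyMeasurable (fun x : E d => gaussDensity d v (w - x)) volume := fun w =>
    (hq.comp (continuous_const.sub continuous_id)).aestronglyMeasurable
  have key := hasFDerivAt_integral_of_dominated_of_fderiv_le (𝕜 := ℝ) (μ := volume) (s := univ)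
    (x₀ := z)
    (F := fun z x => p x * gaussDensity d v (z - x))
    (F' := fun z x => p x • InnerProductSpace.toDual ℝ (E d)
      (-(v⁻¹ * gaussDensity d v (z - x)) • (z - x)))
    (bound := fun x => |p x| * (v⁻¹ * ((1 + 2 * v) * (2 * Real.pi * v) ^ (-(d : ℝ) / 2))))
    Filter.univ_mem (.of_forall fun w => ?_) ?_ ?_ (.of_forall fun x w _ => ?_)
    (hp.abs.mul_const _) (.of_forall fun x w _ => ?_)
  · rw [hasGradientAt_iff_hasFDerivAt]
    have h : gaussConv p v = fun z => ∫ x, p x * gaussDensity d v (z - x) :=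
      funext fun z => gaussConv_eq_integral_mul_sub p v z
    rw [h]
    refine key.congr_fderiv ?_
    rw [← integral_sub_left_eq_self _ volume z, ← integral_smul]
    have hcomm := (InnerProductSpace.toDual ℝ (E d)).toContinuousLinearEquiv.integral_comp_comm
      (μ := volume) fun u => -v⁻¹ • (p (z - u) * gaussDensity d v u) • u
    refine Eq.trans ?_ hcomm
    refine integral_congr_ae (.of_forall fun u => ?_)
    simp [smul_smul]
    ring_nf
  · exact hp.aestronglyMeasurable.mul (hqs w)
  · refine hp.mul_bdd (c := (2 * Real.pi * v) ^ (-(d : ℝ) / 2)) (hqs z) (.of_forall fun u => ?_)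
    rw [Real.norm_of_nonneg (gaussDensity_pos hv _).le]
    exact gaussDensity_le hv _
  · refine hp.aestronglyMeasurable.smul (Continuous.aestronglyMeasurable ?_)
    refine (InnerProductSpace.toDual ℝ (E d)).continuous.comp ?_
    have : Continuous fun x : E d => z - x := by fun_prop
    exact ((continuous_const.mul (hq.comp this)).neg).smul this
  · rw [norm_smul, LinearIsometryEquiv.norm_map, norm_smul, norm_neg, Real.norm_eq_abs,
      Real.norm_of_nonneg (mul_nonneg (inv_pos.2 hv).le (gaussDensity_pos hv _).le), mul_assoc]
    refine mul_le_mul_of_nonneg_left (mul_le_mul_of_nonneg_left ?_ (inv_pos.2 hv).le) (abs_nonneg _)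
    rw [mul_comm]
    exact norm_mul_gaussDensity_le hv _
  · have h := (hasGradientAt_gaussDensity v (w - x)).hasFDerivAt.comp w
      ((hasFDerivAt_id w).sub_const x)
    refine (h.const_mul (p x)).congr_fderiv ?_
    ext y
    simp

/-- Tweedie's formula: the logarithmic derivative divides the gradient by `gaussConv p v z`, which
is the normalisation of `κ_z`. -/
theorem score_gaussConv {d : ℕ} {p : E d → ℝ} (hp : IsDensity p) {v : ℝ} (hv : 0 < v) (z : E d) :
    score (gaussConv p v) z = v⁻¹ • ∫ u, u ∂condLawSummand p (gaussDensity d v) z := by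
  rw [score, (HasGradientAt.neg_log (hasGradientAt_gaussConv hp.integrable hv z)
    (gaussConv_pos hp hv z).ne').gradient, integral_condLawSummand hp hv]
  module

/-! ### Preservation of log-concavity -/

theorem IsLogConcaveFun.gaussConv {d : ℕ} {f : E d → ℝ} (hf : IsLogConcaveFun f)
    (hfm : Measurable f) (hfi : Integrable f) {v : ℝ} (hv : 0 < v) :
    IsLogConcaveFun (gaussConv f v) := by
  have hq := continuous_gaussDensity d v
  have h : GaussConv.gaussConv f v = fun z => ∫ x, f x * gaussDensity d v (z - x) :=
    funext fun z => gaussConv_eq_integral_mul_sub f v z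
  rw [h]
  refine hf.integral_mul_comp (isLogConcaveFun_gaussDensity d hv) hfm hq.measurable
    (LinearMap.snd ℝ (E d) (E d) - LinearMap.fst ℝ (E d) (E d)) (fun z => ?_) fun z => ?_
  · exact measurable_const.sub measurable_id
  · refine hfi.mul_bdd (c := (2 * Real.pi * v) ^ (-(d : ℝ) / 2))
      (hq.comp (continuous_const.sub continuous_id)).aestronglyMeasurable (.of_forall fun u => ?_)
    rw [Real.norm_of_nonneg (gaussDensity_pos hv _).le]
    exact gaussDensity_le hv _

/-- Completing the square in `x`: a Gaussian prior times a Gaussian likelihood is the marginal in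
`z` times the posterior, with mean `(t/(t+v)) z` and variance `tv/(t+v)`. -/
theorem gaussDensity_mul_gaussDensity_sub {d : ℕ} {t v : ℝ} (ht : 0 < t) (hv : 0 < v)
    (x z : E d) : gaussDensity d t x * gaussDensity d v (z - x) =
      gaussDensity d (t + v) z * gaussDensity d (t * v / (t + v)) (x - (t / (t + v)) • z) := by
  have hc : (2 * Real.pi * t) ^ (-(d : ℝ) / 2) * (2 * Real.pi * v) ^ (-(d : ℝ) / 2) =
      (2 * Real.pi * (t + v)) ^ (-(d : ℝ) / 2) *
        (2 * Real.pi * (t * v / (t + v))) ^ (-(d : ℝ) / 2) := by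
    rw [← Real.mul_rpow (by positivity) (by positivity),
      ← Real.mul_rpow (by positivity) (by positivity)]
    congr 1
    field_simp
  unfold gaussDensity
  rw [mul_mul_mul_comm, mul_mul_mul_comm ((2 * Real.pi * (t + v)) ^ (-(d : ℝ) / 2)), hc,
    ← Real.exp_add, ← Real.exp_add, norm_sub_sq_real, norm_sub_sq_real, norm_smul,
    Real.norm_of_nonneg (by positivity), inner_smul_right, real_inner_comm]
  congr 2
  field_simp
  ring

theorem gaussConv_mul_gaussDensity {d : ℕ} (g : E d → ℝ) {t v : ℝ} (ht : 0 < t) (hv : 0 < v)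
    (z : E d) : gaussConv (fun x => g x * gaussDensity d t x) v z =
      (∫ x, g x * gaussDensity d (t * v / (t + v)) (x - (t / (t + v)) • z)) *
        gaussDensity d (t + v) z := by
  rw [gaussConv_eq_integral_mul_sub, ← integral_mul_const]
  refine integral_congr_ae (.of_forall fun x => ?_)
  simp only [mul_assoc, gaussDensity_mul_gaussDensity_sub ht hv]
  ring

theorem IsLogConcaveFun.gaussConv_mul_gaussDensity_mem_SLC1 {d : ℕ} {g : E d → ℝ}
    (hg : IsLogConcaveFun g) (hgm : Measurable g) {t v : ℝ} (ht : 0 < t) (hv : 0 < v)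
    (hfi : Integrable fun x => g x * gaussDensity d t x)
    (hd : IsDensity (GaussConv.gaussConv (fun x => g x * gaussDensity d t x) v)) :
    GaussConv.gaussConv (fun x => g x * gaussDensity d t x) v ∈ SLC1 (t + v) d := by
  have hw : 0 < t * v / (t + v) := by positivity
  refine ⟨hd, _, ?_, fun z => gaussConv_mul_gaussDensity g ht hv z⟩
  refine hg.integral_mul_comp (isLogConcaveFun_gaussDensity d hw) hgm
    (continuous_gaussDensity d _).measurable
    (LinearMap.fst ℝ (E d) (E d) - (t / (t + v)) • LinearMap.snd ℝ (E d) (E d))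
    (fun z => ?_) fun z => ?_
  · exact measurable_id.sub (measurable_const (a := (t / (t + v)) • z))
  · have h : Integrable fun x => g x * gaussDensity d t x * gaussDensity d v (z - x) := by
      refine hfi.mul_bdd (c := (2 * Real.pi * v) ^ (-(d : ℝ) / 2)) ((continuous_gaussDensity d v).comp
        (continuous_const.sub continuous_id)).aestronglyMeasurable (.of_forall fun u => ?_)
      rw [Real.norm_of_nonneg (gaussDensity_pos hv _).le]
      exact gaussDensity_le hv _
    refine (h.const_mul (gaussDensity d (t + v) z)⁻¹).congr (.of_forall fun x => ?_)
    have hz : gaussDensity d (t + v) z ≠ 0 := (gaussDensity_pos (by positivity) z).ne'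
    simp only [mul_assoc, gaussDensity_mul_gaussDensity_sub ht hv]
    rw [mul_left_comm (g x), inv_mul_cancel_left₀ hz]
    rfl

theorem IsLogConcaveRV.add_gauss {Ω : Type*} [MeasurableSpace Ω] {P : Measure Ω}
    [IsProbabilityMeasure P] {d : ℕ} {X W : Ω → E d} {v : ℝ} (hv : 0 < v)
    (hX : IsLogConcaveRV P X) (hW : HasDensity P W (gaussDensity d v)) (hXW : IndepFun X W P) :
    IsLogConcaveRV P fun a => X a + W a := by
  obtain ⟨f, hf, hfc⟩ := hX
  obtain ⟨g, hg, hgm, hgf⟩ := hfc.exists_measurable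
  have hXg := hf.congr hgf.symm hg.nonneg
  exact ⟨_, hXg.add_gauss hv hW hXW, hg.gaussConv hgm hXg.isDensity.integrable hv⟩

theorem IsSLC1RV.add_gauss {Ω : Type*} [MeasurableSpace Ω] {P : Measure Ω}
    [IsProbabilityMeasure P] {d : ℕ} {X W : Ω → E d} {t v : ℝ} (ht : 0 < t) (hv : 0 < v)
    (hX : IsSLC1RV P X t) (hW : HasDensity P W (gaussDensity d v)) (hXW : IndepFun X W P) :
    IsSLC1RV P (fun a => X a + W a) (t + v) := by
  obtain ⟨f, hf, -, g, hg, hfg⟩ := hX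
  obtain ⟨g', hg', hgm, hgg⟩ := hg.exists_measurable
  have hae : f =ᵐ[volume] fun x => g' x * gaussDensity d t x := by
    filter_upwards [hgg] with x hx
    rw [hfg, hx]
  have hXg := hf.congr hae fun x => mul_nonneg (hg'.nonneg x) (gaussDensity_pos ht x).le
  have hZ := hXg.add_gauss hv hW hXW
  exact ⟨_, hZ, hg'.gaussConv_mul_gaussDensity_mem_SLC1 hgm ht hv hXg.isDensity.integrable
    hZ.isDensity⟩

/-! ### Fisher information -/

theorem memLp_two_of_hasLaw_stdGaussian {Ω : Type*} [MeasurableSpace Ω] {P : Measure Ω} {d : ℕ}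
    {G : Ω → E d} (hG : HasLaw G (stdGaussian (E d)) P) : MemLp G 2 P := by
  have h : MemLp id 2 (P.map G) := by rw [hG.map_eq]; exact IsGaussian.memLp_two_id
  exact (memLp_map_measure_iff h.aestronglyMeasurable hG.aemeasurable).1 h

theorem integral_apply_mul_apply_of_hasLaw_stdGaussian {Ω : Type*} [MeasurableSpace Ω]
    {P : Measure Ω} {d : ℕ} {G : Ω → E d} (hG : HasLaw G (stdGaussian (E d)) P) (i j : Fin d) :
    ∫ a, G a i * G a j ∂P = (1 : Matrix (Fin d) (Fin d) ℝ) i j := by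
  have hc := covarianceBilin_apply (μ := stdGaussian (E d)) IsGaussian.memLp_two_id
    (EuclideanSpace.single i 1) (EuclideanSpace.single j 1)
  have hm : ∫ x, id x ∂stdGaussian (E d) = 0 := integral_id_stdGaussian
  rw [covarianceBilin_stdGaussian, hm] at hc
  have hl := hG.integral_comp (f := fun x : E d => x i * x j)
    (Continuous.aestronglyMeasurable (by fun_prop))
  simp only [Function.comp_def] at hl
  rw [hl]
  simp only [sub_zero, EuclideanSpace.inner_single_left, map_one, one_mul] at hc
  rw [← hc, Matrix.one_apply]
  change inner ℝ (EuclideanSpace.single i (1 : ℝ)) (EuclideanSpace.single j 1) = _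
  simp [EuclideanSpace.inner_single_left]

/-- Reduces the matrix order to comparing second moments of the scores in each direction; finiteness
permits exchanging the sums with the integral. -/
theorem dotProduct_fisherInfo_mulVec {Ω : Type*} [MeasurableSpace Ω] {P : Measure Ω} {d : ℕ}
    {Y : Ω → E d} {p : E d → ℝ} (h : HasFiniteFisherInfo P Y p) (x : Fin d → ℝ) :
    dotProduct x ((fisherInfo P Y p).mulVec x) =
      ∫ a, inner ℝ (WithLp.toLp 2 x) (score p (Y a)) ^ 2 ∂P := by
  have h1 : ∀ a, inner ℝ (WithLp.toLp 2 x) (score p (Y a)) ^ 2 =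
      ∑ i, ∑ j, x i * (score p (Y a) i * score p (Y a) j * x j) := by
    intro a
    rw [PiLp.inner_apply, sq, Finset.sum_mul_sum]
    refine Finset.sum_congr rfl fun i _ => Finset.sum_congr rfl fun j _ => ?_
    simp
    ring
  simp_rw [h1]
  rw [integral_finsetSum _ fun i _ => integrable_finsetSum _ fun j _ =>
    ((h i j).mul_const _).const_mul _]
  refine Finset.sum_congr rfl fun i _ => ?_
  rw [integral_finsetSum _ fun j _ => ((h i j).mul_const _).const_mul _, Matrix.mulVec,
    dotProduct, Finset.mul_sum]
  refine Finset.sum_congr rfl fun j _ => ?_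
  rw [integral_const_mul, integral_mul_const]
  rfl

theorem isHermitian_fisherInfo {Ω : Type*} [MeasurableSpace Ω] (P : Measure Ω) {d : ℕ}
    (Y : Ω → E d) (p : E d → ℝ) : (fisherInfo P Y p).IsHermitian := by
  refine Matrix.IsHermitian.ext fun i j => ?_
  simp [fisherInfo, mul_comm]

theorem integrable_id_condLawSummand {d : ℕ} {p : E d → ℝ} (hp : IsDensity p) {v : ℝ}
    (hv : 0 < v) (z : E d) : Integrable (fun u => u) (condLawSummand p (gaussDensity d v) z) :=
  (integrable_condLawSummand_iff hp hv z).2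
    (integrable_comp_sub_mul_gaussDensity_smul hp.integrable hv z)

/-- Tweedie's formula combined with the identification of the conditional law. Pairing with `w`
makes the statement scalar, and the pairing passes inside the mean of `κ_z`. -/
theorem inner_score_gaussConv_ae_eq_condExp {Ω : Type*} [MeasurableSpace Ω] {P : Measure Ω}
    [IsProbabilityMeasure P] {d : ℕ} {X W : Ω → E d} {p : E d → ℝ} {v : ℝ} (hv : 0 < v)
    (hmX : Measurable X) (hmW : Measurable W) (hX : HasDensity P X p)
    (hW : HasDensity P W (gaussDensity d v)) (hXW : IndepFun X W P) (hWi : Integrable W P)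
    (w : E d) :
    (fun a => inner ℝ w (score (gaussConv p v) (X a + W a))) =ᵐ[P]
      P[fun a => inner ℝ (v⁻¹ • w) (W a) |
        MeasurableSpace.comap (fun a => X a + W a) inferInstance] := by
  have h1 := condExp_ae_eq_integral_condDistrib (μ := P) (hmX.add hmW) hW.hasLaw.aemeasurable
    (f := fun u => inner ℝ (v⁻¹ • w) u)
    (Continuous.stronglyMeasurable (by fun_prop)) (hWi.const_inner _)
  have h2 := ae_of_ae_map (hmX.add hmW).aemeasurable (condDistrib_add_gauss hv hX hW hXW)
  refine Filter.EventuallyEq.trans ?_ h1.symm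
  filter_upwards [h2] with a ha
  have ha' : condDistrib W (X + W) P ((X + W) a) =
    condLawSummand p (gaussDensity d v) (X a + W a) := ha
  rw [ha', score_gaussConv hX.isDensity hv,
    integral_inner (integrable_id_condLawSummand hX.isDensity hv _), inner_smul_right,
    inner_smul_left]
  simp

theorem hasFiniteFisherInfo_of_memLp {Ω : Type*} [MeasurableSpace Ω] {P : Measure Ω} {d : ℕ}
    {Y : Ω → E d} {p : E d → ℝ} (h : ∀ w, MemLp (fun a => inner ℝ w (score p (Y a))) 2 P) :
    HasFiniteFisherInfo P Y p := by
  intro i j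
  have hi := h (EuclideanSpace.single i 1)
  have hj := h (EuclideanSpace.single j 1)
  simp only [EuclideanSpace.inner_single_left, map_one, one_mul] at hi hj
  exact hi.integrable_mul hj

theorem integral_condExp_sq_le {Ω : Type*} {m m0 : MeasurableSpace Ω} {P : Measure Ω} {f : Ω → ℝ}
    (hf : MemLp f 2 P) : ∫ a, P[f | m] a ^ 2 ∂P ≤ ∫ a, f a ^ 2 ∂P := by
  have h := integral_norm_condExp_rpow_le (m := m) (μ := P) (p := 2) one_le_two (f := f)
    (by simpa using hf.integrable_sq)
  simpa using h

theorem memLp_inner_score_gaussDensity {Ω : Type*} [MeasurableSpace Ω] {P : Measure Ω} {d : ℕ}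
    {W : Ω → E d} {v : ℝ} (hv : 0 < v) (hW : MemLp W 2 P) (w : E d) :
    MemLp (fun a => inner ℝ w (score (gaussDensity d v) (W a))) 2 P := by
  simp_rw [score_gaussDensity hv, inner_smul_right]
  exact (hW.const_inner w).const_mul _

theorem memLp_inner_score_gaussConv {Ω : Type*} [MeasurableSpace Ω] {P : Measure Ω}
    [IsProbabilityMeasure P] {d : ℕ} {X W : Ω → E d} {p : E d → ℝ} {v : ℝ} (hv : 0 < v)
    (hmX : Measurable X) (hmW : Measurable W) (hX : HasDensity P X p)
    (hW : HasDensity P W (gaussDensity d v)) (hXW : IndepFun X W P) (hW2 : MemLp W 2 P)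
    (w : E d) : MemLp (fun a => inner ℝ w (score (gaussConv p v) (X a + W a))) 2 P :=
  (memLp_congr_ae (inner_score_gaussConv_ae_eq_condExp hv hmX hmW hX hW hXW
    (hW2.integrable one_le_two) w)).2 ((hW2.const_inner _).condExp one_le_two)

/-- In each direction the score of the sum is a conditional expectation of the score of `W`, so
conditional Jensen bounds its second moment. -/
theorem posSemidef_fisherInfo_sub {Ω : Type*} [MeasurableSpace Ω] {P : Measure Ω}
    [IsProbabilityMeasure P] {d : ℕ} {X W : Ω → E d} {p : E d → ℝ} {v : ℝ} (hv : 0 < v)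
    (hmX : Measurable X) (hmW : Measurable W) (hX : HasDensity P X p)
    (hW : HasDensity P W (gaussDensity d v)) (hXW : IndepFun X W P) (hW2 : MemLp W 2 P) :
    (fisherInfo P W (gaussDensity d v) -
      fisherInfo P (fun a => X a + W a) (gaussConv p v)).PosSemidef := by
  refine Matrix.PosSemidef.of_dotProduct_mulVec_nonneg
    ((isHermitian_fisherInfo _ _ _).sub (isHermitian_fisherInfo _ _ _)) fun x => ?_
  rw [star_trivial, Matrix.sub_mulVec, dotProduct_sub, sub_nonneg,
    dotProduct_fisherInfo_mulVec
      (hasFiniteFisherInfo_of_memLp (memLp_inner_score_gaussDensity hv hW2)),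
    dotProduct_fisherInfo_mulVec (hasFiniteFisherInfo_of_memLp
      (memLp_inner_score_gaussConv hv hmX hmW hX hW hXW hW2))]
  have h := inner_score_gaussConv_ae_eq_condExp hv hmX hmW hX hW hXW
    (hW2.integrable one_le_two) (WithLp.toLp 2 x)
  refine (integral_congr_ae (h.pow_const 2)).trans_le ?_
  refine (integral_condExp_sq_le (hW2.const_inner _)).trans_eq ?_
  simp [score_gaussDensity hv, inner_smul_left, inner_smul_right]

theorem fisherInfo_smul_stdGaussian {Ω : Type*} [MeasurableSpace Ω] {P : Measure Ω} {d : ℕ}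
    {G : Ω → E d} (hG : HasLaw G (stdGaussian (E d)) P) {σ : ℝ} (hσ : 0 < σ) :
    fisherInfo P (fun a => σ • G a) (gaussDensity d (σ ^ 2)) =
      (σ ^ 2)⁻¹ • (1 : Matrix (Fin d) (Fin d) ℝ) := by
  ext i j
  rw [Matrix.smul_apply, ← integral_apply_mul_apply_of_hasLaw_stdGaussian hG, smul_eq_mul,
    ← integral_const_mul]
  refine integral_congr_ae (.of_forall fun a => ?_)
  simp only [score_gaussDensity (pow_pos hσ 2), PiLp.smul_apply, smul_eq_mul]
  field_simp

end GaussConv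

theorem mainTheorem12 {Ω : Type*} [MeasurableSpace Ω] (P : Measure Ω) [IsProbabilityMeasure P]
    (d : ℕ) (X G : Ω → GaussConv.E d) (hX : Measurable X) (hG : Measurable G)
    (p : GaussConv.E d → ℝ) (hp : GaussConv.HasDensity P X p)
    (hGlaw : HasLaw G (stdGaussian (GaussConv.E d)) P) (hXG : IndepFun X G P)
    (σ : ℝ) (hσ : 0 < σ)
    (Z : Ω → GaussConv.E d) (hZ : Z = fun a => X a + σ • G a)
    (q : GaussConv.E d → ℝ) (hq : q = GaussConv.gaussDensity d (σ ^ 2)) :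
    -- (i)
    (GaussConv.IsLogConcaveRV P X → GaussConv.IsLogConcaveRV P Z) ∧
    -- (ii)
    (∀ τ : ℝ, 0 < τ → GaussConv.IsSLC1RV P X (τ ^ 2) →
      GaussConv.IsSLC1RV P Z (τ ^ 2 + σ ^ 2)) ∧
    -- the score of `σG`
    GaussConv.HasDensity P (fun a => σ • G a) q ∧
    (∀ x, GaussConv.score q x = (σ ^ 2)⁻¹ • x) ∧
    -- the conditional law of `σG` given `Z = z`
    (∀ z, IsProbabilityMeasure (GaussConv.condLawSummand p q z)) ∧
    (∀ᵐ z ∂(P.map Z),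
      condDistrib (fun a => σ • G a) Z P z = GaussConv.condLawSummand p q z) ∧
    (∀ z, Integrable (fun u => u) (GaussConv.condLawSummand p q z)) ∧
    ∃ pZ : GaussConv.E d → ℝ,
      -- (iii)
      GaussConv.HasDensity P Z pZ ∧ (∀ z, 0 < pZ z) ∧
      ContDiff ℝ ∞ (fun z => -Real.log (pZ z)) ∧
      (∀ z, GaussConv.score pZ z =
        (σ ^ 2)⁻¹ • ∫ u, u ∂(GaussConv.condLawSummand p q z)) ∧
      (∀ z, GaussConv.score pZ z =
        ∫ u, GaussConv.score q u ∂(GaussConv.condLawSummand p q z)) ∧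
      -- (iv)
      GaussConv.HasFiniteFisherInfo P Z pZ ∧
      GaussConv.HasFiniteFisherInfo P (fun a => σ • G a) q ∧
      (GaussConv.fisherInfo P (fun a => σ • G a) q - GaussConv.fisherInfo P Z pZ).PosSemidef ∧
      GaussConv.fisherInfo P (fun a => σ • G a) q =
        (σ ^ 2)⁻¹ • (1 : Matrix (Fin d) (Fin d) ℝ) := by
  subst hZ hq
  have hv : 0 < σ ^ 2 := by positivity
  have hmW : Measurable fun a => σ • G a := hG.const_smul σ
  have hW := GaussConv.hasDensity_smul_of_stdGaussian hGlaw hσ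
  have hXW : IndepFun X (fun a => σ • G a) P :=
    hXG.comp (φ := id) (ψ := fun x => σ • x) measurable_id (by fun_prop)
  have hW2 : MemLp (fun a => σ • G a) 2 P :=
    (GaussConv.memLp_two_of_hasLaw_stdGaussian hGlaw).const_smul σ
  refine ⟨fun h => h.add_gauss hv hW hXW, fun τ hτ h => h.add_gauss (by positivity) hv hW hXW, hW,
    GaussConv.score_gaussDensity hv,
    GaussConv.isProbabilityMeasure_condLawSummand hp.isDensity hv,
    GaussConv.condDistrib_add_gauss hv hp hW hXW,
    GaussConv.integrable_id_condLawSummand hp.isDensity hv,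
    -- The density is built from the given `p`, whereas (i) and (ii) use the convolution of a Borel
    -- log-concave or strongly log-concave version of a density of `X`.
    GaussConv.gaussConv p (σ ^ 2), hp.add_gauss hv hW hXW,
    GaussConv.gaussConv_pos hp.isDensity hv, ?_, GaussConv.score_gaussConv hp.isDensity hv,
    fun z => ?_,
    GaussConv.hasFiniteFisherInfo_of_memLp
      (GaussConv.memLp_inner_score_gaussConv hv hX hmW hp hW hXW hW2),
    GaussConv.hasFiniteFisherInfo_of_memLp (GaussConv.memLp_inner_score_gaussDensity hv hW2),
    GaussConv.posSemidef_fisherInfo_sub hv hX hmW hp hW hXW hW2,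
    GaussConv.fisherInfo_smul_stdGaussian hGlaw hσ⟩
  · exact ((GaussConv.contDiff_gaussConv hp.isDensity.integrable hv).log fun z =>
      (GaussConv.gaussConv_pos hp.isDensity hv z).ne').neg
  · simp_rw [GaussConv.score_gaussDensity hv]
    rw [integral_smul, GaussConv.score_gaussConv hp.isDensity hv]
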